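/- Let $(M^3,J,\theta)$ be a three-dimensional pseudohermitian manifold: $M$ is a smooth (Hausdorff, $\sigma$-compact) three-manifold without boundary, $\theta$ is a real contact form, and $J$ is a complex structure on the contact bundle $\xi=\ker\theta$ such that the Levi form $-i\,d\theta(Z,\overline Z)$ is positive on the $+i$-eigenbundle $T_{1,0}\subset\xi\otimes\mathbb C$ of $J$. Let $T$ be the Reeb field ($\theta(T)=1$, $d\theta(T,\cdot)=0$). In a local frame $Z_1$ of $T_{1,0}$, $Z_{\bar1}=\overline{Z_1}$, with dual coframe $\{\theta,\theta^1,\theta^{\bar1}\}$ of $\{T,Z_1,Z_{\bar1}\}$ normalized by $d\theta=i\theta^1\wedge\theta^{\bar1}$, let the connection form $\theta_1{}^1$ and the torsion $A_{\bar1\bar1}=\overline{A_{11}}$ be determined by $d\theta^1=\theta^1\wedge\theta_1{}^1+A_{\bar1\bar1}\,\theta\wedge\theta^{\bar1}$ and $\theta_1{}^1+\overline{\theta_1{}^1}=0$; indices denote components of covariant derivatives with respect to this connection (indices after a comma for the components of a tensor). Let $E^{0,1}=\langle\theta^{\bar1}\rangle$, $E^{1,0}=\langle\theta^1\rangle$,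 $F^{2,0}=\langle\theta^1\wedge\theta\rangle$ and $F^{2,1}=\langle\theta\wedge d\theta\rangle$ be the spaces of smooth complex forms that are locally multiples of the indicated forms, and put $$d''f=f_{\bar1}\theta^{\bar1},\qquad D^+(\sigma_{\bar1}\theta^{\bar1})=(i\sigma_{\bar1,11}-A_{11}\sigma_{\bar1})\,\theta^1\wedge\theta,\qquad d''(\sigma_1\theta^1\wedge\theta)=\sigma_{1,\bar1}\,\theta^{\bar1}\wedge\theta^1\wedge\theta\in F^{2,1},$$ $$P_3f=(f_{\bar111}+iA_{11}f_{\bar1})\,\theta^1,\qquad \delta_b(\sigma_1\theta^1)=\sigma_{1,\bar1},\qquad P_4f=\delta_b(P_3f).$$ Regard $P_3f\in E^{1,0}$ as an element of $F^{2,0}$ via $\sigma\mapsto\sigma\wedge\theta$. Then $P_3$ and $D^+d''$ are well-defined operators from $C^\infty(M;\mathbb C)$ to $F^{2,0}$, $P_3=-iD^+d''$, and the following hold. (1) Consider these operators on real-valued smooth functions. Let $\mathcal P$ be the space of CR pluriharmonic functions, i.e. of the smooth real-valued functions that are locally the real part of a CR holomorphic function (a function $F$ with $d''F=0$), and let $W$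 be a supplementary space, i.e. a real linear subspace of $C^\infty(M;\mathbb R)$ with $$\ker P_4=\mathcal P\oplus W.$$ Then $f\mapsto P_3f$ is an $\mathbb R$-linear isomorphism of $W$ onto $\ker d''\cap\operatorname{im}P_3\subset F^{2,0}$, and $f\mapsto D^+d''f$ is an $\mathbb R$-linear isomorphism of $W$ onto $\ker d''\cap\operatorname{im}D^+d''\subset F^{2,0}$. (2) Consider these operators on complex-valued smooth functions, and let $W\subset C^\infty(M;\mathbb C)$ be a complex linear subspace with $\ker P_4=\ker P_3\oplus W$. Then $f\mapsto P_3f$ is a $\mathbb C$-linear isomorphism of $W$ onto $\ker d''\cap\operatorname{im}P_3\subset F^{2,0}$, and also onto $\ker d''\cap\operatorname{im}D^+d''$. -/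

import Mathlib

open scoped Manifold ContDiff

noncomputable section

namespace CR

/-! ### Linear relations

The differential operators below are defined by formulas in local frames. An operator is recorded
by its graph, a linear subspace of the product of its source and its target. -/

section Relations

variable {k X Y Z : Type*} [Semiring k] [AddCommMonoid X] [Module k X]
  [AddCommMonoid Y] [Module k Y] [AddCommMonoid Z] [Module k Z]

/-- The kernel of the operator with graph `R`. -/
def relKer (R : Submodule k (X × Y)) : Submodule k X := R.comap (LinearMap.inl k X Y)

/-- The image of the operator with graph `R`. -/
def relIm (R : Submodule k (X × Y)) : Submodule k Y := R.map (LinearMap.snd k X Y)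

/-- The graph of "first `R`, then `Q`". -/
def relComp (R : Submodule k (X × Y)) (Q : Submodule k (Y × Z)) : Submodule k (X × Z) where
  carrier := {x | ∃ y, (x.1, y) ∈ R ∧ (y, x.2) ∈ Q}
  zero_mem' := ⟨0, R.zero_mem, Q.zero_mem⟩
  add_mem' := by
    rintro a b ⟨y, h1, h2⟩ ⟨z, h3, h4⟩
    exact ⟨y + z, R.add_mem h1 h3, Q.add_mem h2 h4⟩
  smul_mem' := by
    rintro c a ⟨y, h1, h2⟩
    exact ⟨c • y, R.smul_mem c h1, Q.smul_mem c h2⟩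

/-- The operator with graph `R` restricts to a linear isomorphism of `W` onto `K`. -/
def IsIsoOnto (R : Submodule k (X × Y)) (W : Submodule k X) (K : Submodule k Y) : Prop :=
  ∃ Φ : W ≃ₗ[k] K, ∀ f : W, ((f : X), (Φ f : Y)) ∈ R

/-- `K = P ⊕ W`. -/
def IsSupplementary (K P W : Submodule k X) : Prop := P ⊓ W = ⊥ ∧ P ⊔ W = K

end Relations

/-! ### Complex functions, vector fields and forms on a smooth three-manifold -/

section Manifold

variable (M : Type*) [TopologicalSpace M] [ChartedSpace (EuclideanSpace ℝ (Fin 3)) M]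

instance : ContMDiffRing 𝓘(ℝ, ℂ) ∞ ℂ :=
  { instNormedSpaceLieAddGroup with
    contMDiff_mul := by
      rw [contMDiff_iff]
      refine ⟨continuous_mul, fun x y => ?_⟩
      simp only [mfld_simps, chartAt_self_eq]
      rw [contDiffOn_univ]
      exact contDiff_mul }

/-- `C^∞(M; ℂ)`. -/
abbrev CF : Type _ := C^∞⟮𝓡 3, M; 𝓘(ℝ, ℂ), ℂ⟯

/-- The constant functions. -/
def constHom : ℂ →+* CF M where
  toFun c := ContMDiffMap.const c
  map_one' := rfl
  map_zero' := rfl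
  map_add' _ _ := rfl
  map_mul' _ _ := rfl

instance : Algebra ℂ (CF M) := (constHom M).toAlgebra

variable {M}

@[simp] theorem CF.smul_apply (c : ℂ) (f : CF M) (p : M) : (c • f) p = c * f p := rfl

@[simp] theorem CF.add_apply (f g : CF M) (p : M) : (f + g) p = f p + g p := rfl

@[simp] theorem CF.mul_apply (f g : CF M) (p : M) : (f * g) p = f p * g p := rfl

@[simp] theorem CF.sub_apply (f g : CF M) (p : M) : (f - g) p = f p - g p := by
  have h : f - g + g = f := sub_add_cancel f g
  have h2 := congrArg (fun u : CF M => u p) h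
  simp only [CF.add_apply] at h2
  exact eq_sub_of_add_eq h2

@[simp] theorem CF.zero_apply (p : M) : (0 : CF M) p = 0 := rfl

instance : IsScalarTower ℝ ℂ (CF M) where
  smul_assoc a c f := by
    ext p
    change (a • c) * f p = a • (c * f p)
    exact smul_mul_assoc a c (f p)

/-- Complex conjugation of functions. -/
def conjF : CF M →+* CF M where
  toFun f := ⟨fun p => (starRingEnd ℂ) (f p), Complex.conjCLE.contDiff.comp_contMDiff f.contMDiff⟩
  map_one' := by ext p; exact map_one (starRingEnd ℂ)
  map_zero' := by ext p; exact map_zero (starRingEnd ℂ)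
  map_add' f g := by ext p; exact map_add (starRingEnd ℂ) (f p) (g p)
  map_mul' f g := by ext p; exact map_mul (starRingEnd ℂ) (f p) (g p)

@[simp] theorem conjF_apply (f : CF M) (p : M) : conjF f p = (starRingEnd ℂ) (f p) := rfl

theorem conjF_conjF (f : CF M) : conjF (conjF f) = f := by
  ext p; exact Complex.conj_conj (f p)

theorem conjF_smul (c : ℂ) (f : CF M) : conjF (c • f) = (starRingEnd ℂ) c • conjF f := by
  ext p; exact map_mul (starRingEnd ℂ) c (f p)

variable (M) in
/-- Smooth sections of `TM ⊗ ℂ`, as derivations of `C^∞(M; ℂ)`; their Lie bracket is the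
commutator of derivations. -/
abbrev Vec : Type _ := Derivation ℂ (CF M) (CF M)

variable (M) in
/-- Smooth complex `1`-forms. -/
abbrev Form1 : Type _ := Vec M →ₗ[CF M] CF M

variable (M) in
/-- Smooth complex covariant `2`-tensors, among them the `2`-forms. -/
abbrev Form2 : Type _ := Vec M →ₗ[CF M] Vec M →ₗ[CF M] CF M

/-- The conjugate vector field. -/
def conjV (V : Vec M) : Vec M :=
  Derivation.mk'
    { toFun := fun f => conjF (V (conjF f))
      map_add' := fun f g => by simp only [map_add]
      map_smul' := fun c f => by
        simp only [conjF_smul, Derivation.map_smul, Complex.conj_conj, RingHom.id_apply] }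
    (fun f g => by
      change conjF (V (conjF (f * g))) = f • conjF (V (conjF g)) + g • conjF (V (conjF f))
      simp only [map_mul, Derivation.leibniz, smul_eq_mul, map_add, conjF_conjF])

theorem conjV_apply (V : Vec M) (f : CF M) : conjV V f = conjF (V (conjF f)) := rfl

/-- The conjugate form `V ↦ conj (α (conj V))`. -/
def conjForm (α : Form1 M) : Form1 M where
  toFun V := conjF (α (conjV V))
  map_add' V W := by
    have h : conjV (V + W) = conjV V + conjV W := by
      ext1 f; simp only [conjV_apply, Derivation.add_apply, map_add]
    rw [h, map_add, map_add]
  map_smul' b V := by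
    have h : conjV (b • V) = conjF b • conjV V := by
      ext1 f; simp only [conjV_apply, Derivation.smul_apply, smul_eq_mul, map_mul]
    rw [h, map_smul, smul_eq_mul, map_mul, conjF_conjF, RingHom.id_apply, smul_eq_mul]

/-- `(α ∧ β)(V, W) = α(V) β(W) - α(W) β(V)`. -/
def wedge (α β : Form1 M) : Form2 M := α.smulRight β - β.smulRight α

/-- The exterior derivative of a `1`-form. -/
def dForm (α : Form1 M) (V W : Vec M) : CF M := V (α W) - W (α V) - α ⁅V, W⁆

variable (M) in
/-- The real subspace of real-valued functions. -/
def realFunctions : Submodule ℝ (CF M) where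
  carrier := {f | ∀ p, (f p).im = 0}
  zero_mem' p := Complex.zero_im
  add_mem' {f g} hf hg p := by simp [hf p, hg p]
  smul_mem' c f hf p := by
    change (c • f p).im = 0
    simp [hf p]

/-! ### Pseudohermitian structures -/

variable (M) in
/-- A pseudohermitian structure `(J, θ)` on the three-manifold `M`. The complex structure on the
contact bundle `ξ = ker θ` is given by its complex linear extension to `ξ ⊗ ℂ`; that both `θ` and
`J` are real is expressed by compatibility with conjugation. -/
structure Pseudohermitian where
  /-- the contact form -/
  θ : Form1 M
  θ_real : conjForm θ = θ
  θ_ne_zero : ∀ p : M, ∃ V : Vec M, θ V p ≠ 0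
  /-- the complex structure on the contact bundle -/
  J : LinearMap.ker θ →ₗ[CF M] LinearMap.ker θ
  J_real : ∀ V W : LinearMap.ker θ, (W : Vec M) = conjV V → (J W : Vec M) = conjV (J V)
  J_sq : ∀ V, J (J V) = -V
  /-- the Levi form `-i dθ(Z, conj Z)` is positive on `T_{1,0}` -/
  levi_pos : ∀ V : LinearMap.ker θ, J V = algebraMap ℂ (CF M) Complex.I • V →
    ∀ p : M, (∃ g : CF M, (V : Vec M) g p ≠ 0) →
      0 < (-Complex.I * dForm θ V (conjV V) p).re

namespace Pseudohermitian

variable (S : Pseudohermitian M)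

/-- Sections of `T_{1,0}`, the `+i`-eigenspace of `J` in `ξ ⊗ ℂ`. -/
def T10 : Submodule (CF M) (Vec M) :=
  (LinearMap.ker (S.J - algebraMap ℂ (CF M) Complex.I • LinearMap.id)).map
    (LinearMap.ker S.θ).subtype

/-- A local frame `{T, Z_1, Z_{\bar 1}}` on an open set `U`, with `T` the Reeb field,
`Z_1` a section of `T_{1,0}` normalized by `h_{1\bar 1} = 1`, together with the dual form `θ^1`,
the connection form `conn = θ_1^1` and the torsion coefficient `A^1_{\bar 1}` determined by
`dθ^1 = θ^1 ∧ θ_1^1 + A^1_{\bar 1} θ ∧ θ^{\bar 1}` and `θ_1^1 + θ_{\bar 1}^{\bar 1} = 0`.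
All objects are global sections and all conditions are imposed on `U` only: after multiplication
by a bump function every local frame is, near any given point, of this kind. -/
structure LocalFrame where
  U : Set M
  isOpen : IsOpen U
  T : Vec M
  Z : Vec M
  θ1 : Form1 M
  conn : Form1 M
  torsion : CF M
  Z_mem : Z ∈ S.T10
  θ_T : ∀ p ∈ U, S.θ T p = 1
  dθ_T : ∀ p ∈ U, ∀ V, dForm S.θ T V p = 0
  θ1_T : ∀ p ∈ U, θ1 T p = 0
  θ1_Z : ∀ p ∈ U, θ1 Z p = 1
  θ1_Zbar : ∀ p ∈ U, θ1 (conjV Z) p = 0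
  levi : ∀ p ∈ U, ∀ V W, dForm S.θ V W p = Complex.I * wedge θ1 (conjForm θ1) V W p
  struct_eq : ∀ p ∈ U, ∀ V W, dForm θ1 V W p =
    wedge θ1 conn V W p + torsion p * wedge S.θ (conjForm θ1) V W p
  skew : ∀ p ∈ U, ∀ V, (conn V + conjForm conn V) p = 0

namespace LocalFrame

variable {S} (F : S.LocalFrame)

/-- `Z_{\bar 1}` -/
def Zbar : Vec M := conjV F.Z

/-- `A_{11}`, the conjugate of `A_{\bar 1\bar 1} = A^1_{\bar 1}` -/
def A11 : CF M := conjF F.torsion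

/-- The derivative in direction `V` of the component `c` of a tensor with `a` lower indices `1` and
`b` lower indices `\bar 1`: `V c - (a θ_1^1(V) + b θ_{\bar 1}^{\bar 1}(V)) c`. -/
def cov (a b : ℕ) (V : Vec M) (c : CF M) : CF M :=
  V c - (a • F.conn V + b • conjForm F.conn V) * c

/-- `σ_{1,\bar 1}` for the component `s = σ_1` -/
def c1bar (s : CF M) : CF M := F.cov 1 0 F.Zbar s

/-- `σ_{\bar 1,11}` for the component `s = σ_{\bar 1}` -/
def cbar11 (s : CF M) : CF M := F.cov 1 1 F.Z (F.cov 0 1 F.Z s)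

theorem cov_add (a b : ℕ) (V : Vec M) (c d : CF M) :
    F.cov a b V (c + d) = F.cov a b V c + F.cov a b V d := by
  simp only [cov, map_add]; ring

theorem cov_smul (a b : ℕ) (V : Vec M) (r : ℂ) (c : CF M) :
    F.cov a b V (r • c) = r • F.cov a b V c := by
  simp only [cov, Derivation.map_smul, mul_smul_comm, smul_sub]

theorem cov_zero (a b : ℕ) (V : Vec M) : F.cov a b V 0 = 0 := by
  simp [cov]

end LocalFrame

/-- `E^{1,0} = ⟨θ^1⟩` -/
def E10 : Submodule (CF M) (Form1 M) where
  carrier := {σ | ∀ F : S.LocalFrame, ∀ p ∈ F.U, ∀ V, σ V p = σ F.Z p * F.θ1 V p}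
  zero_mem' F p _ V := by simp
  add_mem' {σ τ} h1 h2 F p hp V := by
    simp only [LinearMap.add_apply, CF.add_apply, h1 F p hp V, h2 F p hp V, add_mul]
  smul_mem' c σ h F p hp V := by
    simp only [LinearMap.smul_apply, smul_eq_mul, CF.mul_apply, h F p hp V, mul_assoc]

/-- `E^{0,1} = ⟨θ^{\bar 1}⟩` -/
def E01 : Submodule (CF M) (Form1 M) where
  carrier := {σ | ∀ F : S.LocalFrame, ∀ p ∈ F.U, ∀ V,
    σ V p = σ F.Zbar p * conjForm F.θ1 V p}
  zero_mem' F p _ V := by simp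
  add_mem' {σ τ} h1 h2 F p hp V := by
    simp only [LinearMap.add_apply, CF.add_apply, h1 F p hp V, h2 F p hp V, add_mul]
  smul_mem' c σ h F p hp V := by
    simp only [LinearMap.smul_apply, smul_eq_mul, CF.mul_apply, h F p hp V, mul_assoc]

/-- `F^{2,0} = ⟨θ^1 ∧ θ⟩`; the coefficient of `θ^1 ∧ θ` in `η` is `η(Z_1, T)`. -/
def F20 : Submodule (CF M) (Form2 M) where
  carrier := {η | ∀ F : S.LocalFrame, ∀ p ∈ F.U, ∀ V W,
    η V W p = η F.Z F.T p * wedge F.θ1 S.θ V W p}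
  zero_mem' F p _ V W := by simp
  add_mem' {σ τ} h1 h2 F p hp V W := by
    simp only [LinearMap.add_apply, CF.add_apply, h1 F p hp V W, h2 F p hp V W, add_mul]
  smul_mem' c σ h F p hp V W := by
    simp only [LinearMap.smul_apply, smul_eq_mul, CF.mul_apply, h F p hp V W, mul_assoc]

/-- The graph of `d'' = \bar∂_b : E^{0,0} → E^{0,1}`, `f ↦ f_{\bar 1} θ^{\bar 1}`. -/
def dbar : Submodule ℂ (CF M × Form1 M) where
  carrier := {x | x.2 ∈ S.E01 ∧ ∀ F : S.LocalFrame, ∀ p ∈ F.U, x.2 F.Zbar p = F.Zbar x.1 p}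
  zero_mem' := ⟨S.E01.zero_mem, fun F p _ => by simp⟩
  add_mem' {x y} hx hy := ⟨S.E01.add_mem hx.1 hy.1, fun F p hp => by
    simp [hx.2 F p hp, hy.2 F p hp]⟩
  smul_mem' c x hx := ⟨S.E01.smul_of_tower_mem c hx.1, fun F p hp => by
    simp [hx.2 F p hp]⟩

/-- The graph of `D^+ : E^{0,1} → F^{2,0}`,
`σ_{\bar 1} θ^{\bar 1} ↦ (i σ_{\bar 1,11} - A_{11} σ_{\bar 1}) θ^1 ∧ θ`. -/
def Dplus : Submodule ℂ (Form1 M × Form2 M) where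
  carrier := {x | x.1 ∈ S.E01 ∧ x.2 ∈ S.F20 ∧ ∀ F : S.LocalFrame, ∀ p ∈ F.U,
    x.2 F.Z F.T p = (Complex.I • F.cbar11 (x.1 F.Zbar) - F.A11 * x.1 F.Zbar) p}
  zero_mem' := ⟨S.E01.zero_mem, S.F20.zero_mem, fun F p _ => by
    simp [LocalFrame.cbar11, LocalFrame.cov_zero]⟩
  add_mem' {x y} hx hy := ⟨S.E01.add_mem hx.1 hy.1, S.F20.add_mem hx.2.1 hy.2.1, fun F p hp => by
    simp only [Prod.snd_add, Prod.fst_add, LinearMap.add_apply, CF.add_apply, hx.2.2 F p hp,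
      hy.2.2 F p hp, LocalFrame.cbar11, LocalFrame.cov_add, CF.sub_apply, CF.smul_apply,
      CF.mul_apply]
    ring⟩
  smul_mem' c x hx := ⟨S.E01.smul_of_tower_mem c hx.1, S.F20.smul_of_tower_mem c hx.2.1,
    fun F p hp => by
      simp only [Prod.smul_snd, Prod.smul_fst, LinearMap.smul_apply, hx.2.2 F p hp,
        LocalFrame.cbar11, LocalFrame.cov_smul, CF.sub_apply, CF.smul_apply, CF.mul_apply]
      ring⟩

/-- The graph of `d'' : F^{2,0} → F^{2,1}`,
`σ_1 θ^1 ∧ θ ↦ σ_{1,\bar 1} θ^{\bar 1} ∧ θ^1 ∧ θ = i σ_{1,\bar 1} θ ∧ dθ`. The bundle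
`F^{2,1} = ⟨θ ∧ dθ⟩` is identified with the trivial one via the coefficient of `θ ∧ dθ`. -/
def dbarF20 : Submodule ℂ (Form2 M × CF M) where
  carrier := {x | x.1 ∈ S.F20 ∧ ∀ F : S.LocalFrame, ∀ p ∈ F.U,
    x.2 p = (Complex.I • F.c1bar (x.1 F.Z F.T)) p}
  zero_mem' := ⟨S.F20.zero_mem, fun F p _ => by
    simp [LocalFrame.c1bar, LocalFrame.cov_zero]⟩
  add_mem' {x y} hx hy := ⟨S.F20.add_mem hx.1 hy.1, fun F p hp => by
    simp only [Prod.snd_add, Prod.fst_add, LinearMap.add_apply, CF.add_apply, hx.2 F p hp,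
      hy.2 F p hp, LocalFrame.c1bar, LocalFrame.cov_add, CF.smul_apply]
    ring⟩
  smul_mem' c x hx := ⟨S.F20.smul_of_tower_mem c hx.1, fun F p hp => by
    simp only [Prod.smul_snd, Prod.smul_fst, LinearMap.smul_apply, hx.2 F p hp,
      LocalFrame.c1bar, LocalFrame.cov_smul, CF.smul_apply]
    ring⟩

/-- The graph of `P_3 : E^{0,0} → E^{1,0}`,
`f ↦ (f_{\bar 1}{}^{\bar 1}{}_1 + i A_{11} f^1) θ^1`; as `h_{1\bar 1} = 1`, the coefficient is
`f_{\bar 1 1 1} + i A_{11} f_{\bar 1}`. -/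
def P3 : Submodule ℂ (CF M × Form1 M) where
  carrier := {x | x.2 ∈ S.E10 ∧ ∀ F : S.LocalFrame, ∀ p ∈ F.U,
    x.2 F.Z p = (F.cbar11 (F.Zbar x.1) + Complex.I • (F.A11 * F.Zbar x.1)) p}
  zero_mem' := ⟨S.E10.zero_mem, fun F p _ => by
    simp [LocalFrame.cbar11, LocalFrame.cov_zero]⟩
  add_mem' {x y} hx hy := ⟨S.E10.add_mem hx.1 hy.1, fun F p hp => by
    simp only [Prod.snd_add, Prod.fst_add, LinearMap.add_apply, CF.add_apply, hx.2 F p hp,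
      hy.2 F p hp, LocalFrame.cbar11, LocalFrame.cov_add, CF.smul_apply, map_add,
      CF.mul_apply]
    ring⟩
  smul_mem' c x hx := ⟨S.E10.smul_of_tower_mem c hx.1, fun F p hp => by
    simp only [Prod.smul_snd, Prod.smul_fst, LinearMap.smul_apply, hx.2 F p hp, CF.add_apply,
      LocalFrame.cbar11, LocalFrame.cov_smul, CF.smul_apply, CF.mul_apply, Derivation.map_smul]
    ring⟩

/-- The graph of the divergence `δ_b : E^{1,0} → E^{0,0}`, `σ_1 θ^1 ↦ σ_{1,}{}^1`; as
`h_{1\bar 1} = 1`, this is `σ_{1,\bar 1}`. -/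
def divergence : Submodule ℂ (Form1 M × CF M) where
  carrier := {x | x.1 ∈ S.E10 ∧ ∀ F : S.LocalFrame, ∀ p ∈ F.U, x.2 p = F.c1bar (x.1 F.Z) p}
  zero_mem' := ⟨S.E10.zero_mem, fun F p _ => by
    simp [LocalFrame.c1bar, LocalFrame.cov_zero]⟩
  add_mem' {x y} hx hy := ⟨S.E10.add_mem hx.1 hy.1, fun F p hp => by
    simp only [Prod.snd_add, Prod.fst_add, LinearMap.add_apply, CF.add_apply, hx.2 F p hp,
      hy.2 F p hp, LocalFrame.c1bar, LocalFrame.cov_add]⟩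
  smul_mem' c x hx := ⟨S.E10.smul_of_tower_mem c hx.1, fun F p hp => by
    simp only [Prod.smul_snd, Prod.smul_fst, LinearMap.smul_apply, hx.2 F p hp,
      LocalFrame.c1bar, LocalFrame.cov_smul, CF.smul_apply]⟩

/-- The CR Paneitz operator `P_4 = δ_b P_3`. -/
def P4 : Submodule ℂ (CF M × CF M) := relComp S.P3 S.divergence

/-- The identification `E^{1,0} ≅ F^{2,0}`, `σ ↦ σ ∧ θ`. -/
def wedgeθ : Form1 M →ₗ[ℂ] Form2 M where
  toFun σ := wedge σ S.θ
  map_add' σ τ := by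
    ext V W p; simp [wedge]; ring
  map_smul' c σ := by
    ext V W p; simp [wedge]; ring

/-- `P_3`, with values in `F^{2,0}`. -/
def P3F20 : Submodule ℂ (CF M × Form2 M) := relComp S.P3 S.wedgeθ.graph

/-- `D^+ d'' : E^{0,0} → F^{2,0}`. -/
def DplusDbar : Submodule ℂ (CF M × Form2 M) := relComp S.dbar S.Dplus

/-- `F` is a CR holomorphic function on `U`. -/
def IsCROn (F : CF M) (U : Set M) : Prop := ∀ Z ∈ S.T10, ∀ p ∈ U, conjV Z F p = 0

/-- The (real) space of CR pluriharmonic functions: the smooth real-valued functions that are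
locally the real part of a CR holomorphic function. -/
def pluriharmonic : Submodule ℝ (CF M) where
  carrier := {f | ∀ p : M, ∃ U : Set M, IsOpen U ∧ p ∈ U ∧
    ∃ F : CF M, S.IsCROn F U ∧ ∀ q ∈ U, f q = ((F q).re : ℂ)}
  zero_mem' p := ⟨Set.univ, isOpen_univ, trivial, 0, fun Z _ q _ => by simp, fun q _ => by simp⟩
  add_mem' {f g} hf hg p := by
    obtain ⟨U, hU, hpU, F, hF, hfF⟩ := hf p
    obtain ⟨V, hV, hpV, G, hG, hgG⟩ := hg p
    refine ⟨U ∩ V, hU.inter hV, ⟨hpU, hpV⟩, F + G, fun Z hZ q hq => ?_, fun q hq => ?_⟩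
    · simp [hF Z hZ q hq.1, hG Z hZ q hq.2]
    · simp [hfF q hq.1, hgG q hq.2]
  smul_mem' c f hf p := by
    obtain ⟨U, hU, hpU, F, hF, hfF⟩ := hf p
    refine ⟨U, hU, hpU, (c : ℂ) • F, fun Z hZ q hq => ?_, fun q hq => ?_⟩
    · simp [hF Z hZ q hq]
    · change c • f q = (((c : ℂ) * F q).re : ℂ)
      simp [hfF q hq]

end Pseudohermitian

/-- The restriction to real-valued functions of the operator with graph `R`. -/
def onReal {Y : Type*} [AddCommMonoid Y] [Module ℝ Y] [Module ℂ Y] [IsScalarTower ℝ ℂ Y]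
    (R : Submodule ℂ (CF M × Y)) : Submodule ℝ (CF M × Y) :=
  R.restrictScalars ℝ ⊓ (realFunctions M).prod ⊤

end Manifold

end CR

end

/-!
`D^+ d'' = i P_3` and, under `E^{1,0} ≅ F^{2,0}`, the divergence is `d''` up to the factor `i`;
hence `ker P_4` is the kernel of `d'' P_3`, and an operator maps every complement of its kernel in
the kernel of `d'' P_3` isomorphically onto `ker d'' ∩ im P_3`. For this one needs that `P_3` is
globally defined and that its real kernel consists of the CR pluriharmonic functions. Both follow
from Rumin's lift: the form `i (f_{\bar 1} θ^{\bar 1} - f_1 θ^1)` on the contact bundle extends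
uniquely to a `1`-form `α` on `M` whose exterior derivative vanishes on the contact bundle, and
`dα(T, Z_1) = 2 (f_{\bar 1 1 1} + i A_{11} f_{\bar 1})` is twice the coefficient of `P_3 f`. For
real `f` in the kernel of `P_3` the real form `α` is therefore closed, and `f + i g` is CR
holomorphic for each local primitive `g` of `α` given by the Poincaré lemma.
-/

noncomputable section

namespace CR

open Topology Filter MeasureTheory

section Calculus

variable {E F ι : Type*} [NormedAddCommGroup E] [NormedSpace ℝ E] [NormedAddCommGroup F]
  [NormedSpace ℝ F] [Fintype ι] [DecidableEq ι]

theorem integral_unitInterval_eq_convolution (ψ : ContDiffBump (0 : ℝ)) (hψ : 1 ≤ ψ.rIn)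
    (u : ℝ → F) :
    ∫ t in (0 : ℝ)..1, u t =
      convolution ((Set.Ioc (0 : ℝ) 1).indicator fun _ => (1 : ℝ)) (fun s => ψ s • u (-s))
        (ContinuousLinearMap.lsmul ℝ ℝ) volume 0 := by
  rw [convolution, intervalIntegral.integral_of_le zero_le_one,
    ← integral_indicator measurableSet_Ioc]
  congr 1
  ext t
  by_cases ht : t ∈ Set.Ioc (0 : ℝ) 1
  · have hψt : ψ (-t) = 1 := ψ.one_of_mem_closedBall (by
      simpa only [Metric.mem_closedBall, dist_zero_right, norm_neg, Real.norm_eq_abs,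
        abs_of_pos ht.1] using ht.2.trans hψ)
    simp [ht, hψt]
  · simp [ht]

-- The cutoff `ψ` makes the integral over `[0, 1]` a convolution with a compactly supported kernel.
theorem contDiff_integral_unitInterval {G : E → ℝ → F} (hG : ContDiff ℝ ∞ (Function.uncurry G)) :
    ContDiff ℝ ∞ fun y => ∫ t in (0 : ℝ)..1, G y t := by
  let ψ : ContDiffBump (0 : ℝ) := ⟨1, 2, one_pos, one_lt_two⟩
  have integrable : LocallyIntegrable ((Set.Ioc (0 : ℝ) 1).indicator fun _ => (1 : ℝ)) :=
    ((integrable_indicator_iff measurableSet_Ioc).2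
      (integrableOn_const (by simp) (by simp))).locallyIntegrable
  have smooth : ContDiff ℝ ∞ (Function.uncurry fun (y : E) (s : ℝ) => ψ s • G y (-s)) :=
    (ψ.contDiff.comp contDiff_snd).smul (hG.comp (contDiff_fst.prodMk contDiff_snd.neg))
  have support : ∀ (y : E) (s : ℝ), y ∈ Set.univ → s ∉ Metric.closedBall 0 2 →
      ψ s • G y (-s) = 0 := fun y s _ hs => by
    rw [ψ.zero_of_le_dist (not_le.1 hs).le, zero_smul]
  simp only [integral_unitInterval_eq_convolution ψ le_rfl]
  exact contDiffOn_univ.1 (contDiffOn_convolution_right_with_param_comp (n := ⊤)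
    (ContinuousLinearMap.lsmul ℝ ℝ) contDiffOn_const isOpen_univ (isCompact_closedBall 0 2)
    support integrable smooth.contDiffOn)

theorem exists_hadamard_quotient [CompleteSpace F] {h : E → F} (hh : ContDiff ℝ ∞ h)
    (a : E) :
    ∃ g : E → E →L[ℝ] F, ContDiff ℝ ∞ g ∧ g a = fderiv ℝ h a ∧ ∀ y, h y = h a + g y (y - a) := by
  have smooth : ContDiff ℝ ∞
      (Function.uncurry fun (y : E) (t : ℝ) => fderiv ℝ h (a + t • (y - a))) :=
    (hh.fderiv_right (by simp)).comp (by fun_prop)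
  refine ⟨fun y => ∫ t in (0 : ℝ)..1, fderiv ℝ h (a + t • (y - a)),
    contDiff_integral_unitInterval smooth, by simp, fun y => ?_⟩
  have continuous_fderiv : Continuous fun t : ℝ => fderiv ℝ h (a + t • (y - a)) :=
    smooth.continuous.comp (Continuous.prodMk_right y)
  have hasDerivAt (t : ℝ) : HasDerivAt (fun t : ℝ => h (a + t • (y - a)))
      (fderiv ℝ h (a + t • (y - a)) (y - a)) t := by
    have line : HasDerivAt (fun t : ℝ => a + t • (y - a)) (y - a) t := by
      simpa using ((hasDerivAt_id t).smul_const (y - a)).const_add a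
    exact (hh.differentiable (by simp) _).hasFDerivAt.comp_hasDerivAt t line
  rw [ContinuousLinearMap.intervalIntegral_apply (continuous_fderiv.intervalIntegrable 0 1),
    intervalIntegral.integral_eq_sub_of_hasDerivAt (fun t _ => hasDerivAt t)
      ((continuous_fderiv.clm_apply continuous_const).intervalIntegrable 0 1)]
  simp

theorem exists_hadamard_quotients [CompleteSpace F] {h : EuclideanSpace ℝ ι → F}
    (hh : ContDiff ℝ ∞ h) (a : EuclideanSpace ℝ ι) :
    ∃ g : ι → EuclideanSpace ℝ ι → F, (∀ i, ContDiff ℝ ∞ (g i)) ∧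
      (∀ i, g i a = fderiv ℝ h a (EuclideanSpace.single i 1)) ∧
      ∀ y, h y = h a + ∑ i, (y i - a i) • g i y := by
  obtain ⟨g, hg, hga, hgy⟩ := exists_hadamard_quotient hh a
  refine ⟨fun i y => g y (EuclideanSpace.single i 1), fun i => hg.clm_apply contDiff_const,
    fun i => by simp only [hga], fun y => ?_⟩
  have hy : y - a = ∑ i, (y i - a i) • EuclideanSpace.single i (1 : ℝ) := by
    ext j
    simp [Finset.sum_apply, Pi.single_apply]
  simp only [hgy y, ← map_smul, ← map_sum, ← hy]

theorem exists_primitive_of_fderiv_symmetric [CompleteSpace F]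
    {s : Set (EuclideanSpace ℝ ι)} (hs : Convex ℝ s) (ho : IsOpen s)
    {a : ι → EuclideanSpace ℝ ι → F} (ha : ∀ i, ContDiffOn ℝ ∞ (a i) s)
    (closed : ∀ y ∈ s, ∀ i j, fderiv ℝ (a j) y (EuclideanSpace.single i 1) =
      fderiv ℝ (a i) y (EuclideanSpace.single j 1)) :
    ∃ G : EuclideanSpace ℝ ι → F, ContDiffOn ℝ ∞ G s ∧
      ∀ y ∈ s, ∀ i, fderiv ℝ G y (EuclideanSpace.single i 1) = a i y := by
  let α : EuclideanSpace ℝ ι → EuclideanSpace ℝ ι →L[ℝ] F := fun y =>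
    ∑ j, (EuclideanSpace.proj j : EuclideanSpace ℝ ι →L[ℝ] ℝ).smulRight (a j y)
  have α_single (y i) : α y (EuclideanSpace.single i 1) = a i y := by
    simp [α]
  have α_smooth : ContDiffOn ℝ ∞ α s := ContDiffOn.sum fun j _ => contDiffOn_const.smulRight (ha j)
  have α_diff : DifferentiableOn ℝ α s := α_smooth.differentiableOn (by simp)
  have fderiv_α (y) (hy : y ∈ s) (u i) :
      fderiv ℝ α y u (EuclideanSpace.single i 1) = fderiv ℝ (a i) y u := by
    have := ((α_diff.differentiableAt (ho.mem_nhds hy)).hasFDerivAt.clm_apply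
      (hasFDerivAt_const (EuclideanSpace.single i (1 : ℝ)) y)).fderiv
    simp only [α_single] at this
    simp [this]
  have α_closed (y) (hy : y ∈ s) (u v) : fderiv ℝ α y u v = fderiv ℝ α y v u := by
    let β := (fderiv ℝ α y).toLinearMap₁₂
    have : β = β.flip := LinearMap.ext_basis (EuclideanSpace.basisFun ι ℝ).toBasis
      (EuclideanSpace.basisFun ι ℝ).toBasis fun i j => by
        simp [β, fderiv_α y hy, closed y hy i j]
    exact LinearMap.congr_fun₂ this u v
  obtain ⟨G, hG⟩ := hs.exists_forall_hasFDerivAt_of_fderiv_symmetric ho α_diff α_closed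
  refine ⟨G, (contDiffOn_infty_iff_fderiv_of_isOpen ho).2
    ⟨fun y hy => (hG y hy).differentiableAt.differentiableWithinAt,
      α_smooth.congr fun y hy => (hG y hy).fderiv⟩, fun y hy i => ?_⟩
  rw [(hG y hy).fderiv, α_single]

end Calculus

section Germs

variable {E H M F : Type*} [NormedAddCommGroup E] [NormedSpace ℝ E] [FiniteDimensional ℝ E]
  [TopologicalSpace H] {I : ModelWithCorners ℝ E H} [TopologicalSpace M] [ChartedSpace H M]
  [T2Space M] [IsManifold I ∞ M] [NormedAddCommGroup F] [NormedSpace ℝ F]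

theorem exists_contMDiffMap_eventuallyEq {f : M → F} {p : M} {W : Set M} (hW : W ∈ 𝓝 p)
    (hf : ContMDiffOn I 𝓘(ℝ, F) ∞ f W) : ∃ g : C^∞⟮I, M; 𝓘(ℝ, F), F⟯, g =ᶠ[𝓝 p] f := by
  obtain ⟨W', hW'W, hW'o, hpW'⟩ := mem_nhds_iff.1 hW
  obtain ⟨b, -, hb⟩ := (SmoothBumpFunction.nhds_basis_tsupport (I := I) p).mem_iff.1
    (hW'o.mem_nhds hpW')
  refine ⟨⟨fun q => b q • f q, contMDiff_of_tsupport fun q hq => ?_⟩, ?_⟩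
  · have hqW : q ∈ W' := hb (tsupport_smul_subset_left _ _ hq)
    exact b.contMDiffAt.smul ((hf.mono hW'W).contMDiffAt (hW'o.mem_nhds hqW))
  · filter_upwards [b.eventuallyEq_one] with q hq
    change b q • f q = f q
    rw [hq]
    exact one_smul ℝ (f q)

end Germs

section Derivations

variable {M : Type*} [TopologicalSpace M] [ChartedSpace (EuclideanSpace ℝ (Fin 3)) M]

@[simp] theorem CF.neg_apply (f : CF M) (p : M) : (-f) p = -f p := rfl

@[simp] theorem CF.algebraMap_apply (c : ℂ) (p : M) : (algebraMap ℂ (CF M) c) p = c := rfl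

@[simp] theorem CF.sum_apply {ι : Type*} (s : Finset ι) (f : ι → CF M) (p : M) :
    (∑ i ∈ s, f i) p = ∑ i ∈ s, f i p := by
  classical
  induction s using Finset.induction_on with
  | empty => simp
  | insert a s ha ih => simp [Finset.sum_insert ha, ih]

variable [T2Space M] [IsManifold (𝓡 3) ∞ M]

theorem exists_bump {p : M} {W : Set M} (hW : W ∈ 𝓝 p) :
    ∃ χ : CF M, (∀ᶠ q in 𝓝 p, χ q = 1) ∧ ∀ q ∉ W, χ q = 0 := by
  obtain ⟨b, -, hb⟩ := (SmoothBumpFunction.nhds_basis_tsupport (I := 𝓡 3) p).mem_iff.1 hW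
  refine ⟨⟨fun q => (b q : ℂ), Complex.ofRealCLM.contDiff.comp_contMDiff b.contMDiff⟩, ?_, ?_⟩
  · filter_upwards [b.eventuallyEq_one] with q hq
    exact congrArg Complex.ofReal hq
  · exact fun q hq => congrArg Complex.ofReal
      (image_eq_zero_of_notMem_tsupport fun h => hq (hb h))

theorem Vec.apply_congr (V : Vec M) {f g : CF M} {p : M} (h : f =ᶠ[𝓝 p] g) : V f p = V g p := by
  obtain ⟨χ, hχ1, hχ0⟩ := exists_bump h
  have vanish : χ * (f - g) = 0 := by
    ext q
    by_cases hq : f q = g q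
    · simp [hq]
    · simp [hχ0 q hq]
  have leibniz : V (χ * (f - g)) p = V f p - V g p := by
    simp [hχ1.self_of_nhds, h.self_of_nhds]
  rwa [vanish, map_zero, CF.zero_apply, eq_comm, sub_eq_zero] at leibniz

theorem Vec.congr_on (V : Vec M) {f g : CF M} {U : Set M} (hU : IsOpen U)
    (h : ∀ q ∈ U, f q = g q) {p : M} (hp : p ∈ U) : V f p = V g p :=
  V.apply_congr (eventually_of_mem (hU.mem_nhds hp) h)

end Derivations

section Charts

variable {M : Type*} [TopologicalSpace M] [ChartedSpace (EuclideanSpace ℝ (Fin 3)) M] {p q : M}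

/-- The derivative of `f` at `q` in the direction `v` of the chart at `p`. -/
def chartDeriv (p : M) (v : EuclideanSpace ℝ (Fin 3)) (f : CF M) (q : M) : ℂ :=
  fderiv ℝ (f ∘ (extChartAt (𝓡 3) p).symm) (extChartAt (𝓡 3) p q) v

theorem chartDeriv_eq_fderiv (v : EuclideanSpace ℝ (Fin 3)) {f : CF M}
    {h : EuclideanSpace ℝ (Fin 3) → ℂ} (hq : q ∈ (extChartAt (𝓡 3) p).source)
    (hf : ∀ᶠ q' in 𝓝 q, f q' = h (extChartAt (𝓡 3) p q')) :
    chartDeriv p v f q = fderiv ℝ h (extChartAt (𝓡 3) p q) v := by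
  have target := (extChartAt (𝓡 3) p).map_source hq
  have tendsto : Tendsto (extChartAt (𝓡 3) p).symm (𝓝 (extChartAt (𝓡 3) p q)) (𝓝 q) := by
    simpa only [ContinuousAt, (extChartAt (𝓡 3) p).left_inv hq] using
      continuousAt_extChartAt_symm'' (I := 𝓡 3) target
  have germ : f ∘ (extChartAt (𝓡 3) p).symm =ᶠ[𝓝 (extChartAt (𝓡 3) p q)] h := by
    filter_upwards [tendsto.eventually hf,
      (isOpen_extChartAt_target (I := 𝓡 3) p).mem_nhds target] with y hy hyt
    rw [Function.comp_apply, hy, (extChartAt (𝓡 3) p).right_inv hyt]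
  rw [chartDeriv, germ.fderiv_eq]

/-- A neighbourhood of `p` on which cutting off by `b` has no effect. -/
def coordDomain (b : SmoothBumpFunction (𝓡 3) p) : Set M := interior {q | b q = 1}

section Cutoff

variable {b : SmoothBumpFunction (𝓡 3) p}

theorem isOpen_coordDomain : IsOpen (coordDomain b) := isOpen_interior

theorem bump_eq_one (hq : q ∈ coordDomain b) : b q = 1 :=
  (interior_subset hq : q ∈ {q | b q = 1})

theorem mem_coordDomain : p ∈ coordDomain b :=
  mem_interior_iff_mem_nhds.2 b.eventuallyEq_one

theorem bump_smul_congr [T2Space M] {x y : ℂ}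
    (h : q ∈ (extChartAt (𝓡 3) p).source → x = y) : b q • x = b q • y := by
  by_cases hq : q ∈ (extChartAt (𝓡 3) p).source
  · rw [h hq]
  · simp [image_eq_zero_of_notMem_tsupport fun h => hq (b.tsupport_subset_extChartAt_source h)]

theorem coordDomain_subset_source [T2Space M] :
    coordDomain b ⊆ (extChartAt (𝓡 3) p).source := fun q hq => by
  by_contra h
  exact zero_ne_one ((image_eq_zero_of_notMem_tsupport fun h' =>
    h (b.tsupport_subset_extChartAt_source h')).symm.trans (bump_eq_one hq))

end Cutoff

variable [IsManifold (𝓡 3) ∞ M]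

theorem CF.contDiffOn_comp_extChartAt_symm (f : CF M) (p : M) :
    ContDiffOn ℝ ∞ (f ∘ (extChartAt (𝓡 3) p).symm) (extChartAt (𝓡 3) p).target :=
  (f.contMDiff.comp_contMDiffOn (contMDiffOn_extChartAt_symm p)).contDiffOn

theorem CF.differentiableAt_comp_extChartAt_symm (f : CF M)
    (hq : q ∈ (extChartAt (𝓡 3) p).source) :
    DifferentiableAt ℝ (f ∘ (extChartAt (𝓡 3) p).symm) (extChartAt (𝓡 3) p q) :=
  ((f.contDiffOn_comp_extChartAt_symm p).contDiffAt ((isOpen_extChartAt_target p).mem_nhds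
    ((extChartAt (𝓡 3) p).map_source hq))).differentiableAt (by simp)

theorem contMDiffOn_comp_extChartAt {F : Type*} [NormedAddCommGroup F] [NormedSpace ℝ F]
    {h : EuclideanSpace ℝ (Fin 3) → F} {s : Set (EuclideanSpace ℝ (Fin 3))}
    (hh : ContDiffOn ℝ ∞ h s) :
    ContMDiffOn (𝓡 3) 𝓘(ℝ, F) ∞ (fun q => h (extChartAt (𝓡 3) p q))
      ((extChartAt (𝓡 3) p).source ∩ extChartAt (𝓡 3) p ⁻¹' s) := by
  refine hh.contMDiffOn.comp (t := s) ((contMDiffOn_extChartAt (x := p)).mono ?_)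
    Set.inter_subset_right
  rw [extChartAt_source]
  exact Set.inter_subset_left

theorem contMDiffOn_chartDeriv (p : M) (v : EuclideanSpace ℝ (Fin 3)) (f : CF M) :
    ContMDiffOn (𝓡 3) 𝓘(ℝ, ℂ) ∞ (chartDeriv p v f) (extChartAt (𝓡 3) p).source := by
  have smooth : ContDiffOn ℝ ∞ (fun y => fderiv ℝ (f ∘ (extChartAt (𝓡 3) p).symm) y v)
      (extChartAt (𝓡 3) p).target :=
    ((f.contDiffOn_comp_extChartAt_symm p).fderiv_of_isOpen (isOpen_extChartAt_target p)
      (by simp)).clm_apply contDiffOn_const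
  exact (contMDiffOn_comp_extChartAt (p := p) smooth).mono fun q hq =>
    ⟨hq, (extChartAt (𝓡 3) p).map_source hq⟩

theorem chartDeriv_add (v : EuclideanSpace ℝ (Fin 3)) (f g : CF M)
    (hq : q ∈ (extChartAt (𝓡 3) p).source) :
    chartDeriv p v (f + g) q = chartDeriv p v f q + chartDeriv p v g q :=
  congrArg (· v) (fderiv_add (f.differentiableAt_comp_extChartAt_symm hq)
    (g.differentiableAt_comp_extChartAt_symm hq))

theorem chartDeriv_mul (v : EuclideanSpace ℝ (Fin 3)) (f g : CF M)
    (hq : q ∈ (extChartAt (𝓡 3) p).source) :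
    chartDeriv p v (f * g) q = f q * chartDeriv p v g q + g q * chartDeriv p v f q := by
  have product : ((f * g : CF M) : M → ℂ) ∘ (extChartAt (𝓡 3) p).symm =
    (f ∘ (extChartAt (𝓡 3) p).symm) * (g ∘ (extChartAt (𝓡 3) p).symm) := rfl
  rw [chartDeriv, product, fderiv_mul (f.differentiableAt_comp_extChartAt_symm hq)
    (g.differentiableAt_comp_extChartAt_symm hq)]
  simp only [_root_.add_apply, _root_.smul_apply, Function.comp_apply,
    (extChartAt (𝓡 3) p).left_inv hq, smul_eq_mul, chartDeriv]

theorem chartDeriv_smul (v : EuclideanSpace ℝ (Fin 3)) (c : ℂ) (f : CF M)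
    (hq : q ∈ (extChartAt (𝓡 3) p).source) :
    chartDeriv p v (c • f) q = c * chartDeriv p v f q := by
  have const : chartDeriv p v (algebraMap ℂ (CF M) c) q = 0 := by
    rw [chartDeriv_eq_fderiv v (f := algebraMap ℂ (CF M) c) (h := fun _ => c) hq
      (Eventually.of_forall fun _ => rfl)]
    simp
  simp [Algebra.smul_def, chartDeriv_mul v _ _ hq, const]

theorem CF.exists_contDiff_eventuallyEq (f : CF M) (hq : q ∈ (extChartAt (𝓡 3) p).source) :
    ∃ h : EuclideanSpace ℝ (Fin 3) → ℂ, ContDiff ℝ ∞ h ∧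
      ∀ᶠ q' in 𝓝 q, f q' = h (extChartAt (𝓡 3) p q') := by
  obtain ⟨h, hh⟩ := exists_contMDiffMap_eventuallyEq
    ((isOpen_extChartAt_target p).mem_nhds ((extChartAt (𝓡 3) p).map_source hq))
    (f.contDiffOn_comp_extChartAt_symm p).contMDiffOn
  refine ⟨h, h.contMDiff.contDiff, ?_⟩
  filter_upwards [(continuousAt_extChartAt' hq).eventually hh,
    (isOpen_extChartAt_source (I := 𝓡 3) p).mem_nhds hq] with q' hq' hs
  rw [hq', Function.comp_apply, (extChartAt (𝓡 3) p).left_inv hs]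

variable [T2Space M]

theorem exists_eventuallyEq_comp_extChartAt {h : EuclideanSpace ℝ (Fin 3) → ℂ}
    {s : Set (EuclideanSpace ℝ (Fin 3))} (hq : q ∈ (extChartAt (𝓡 3) p).source)
    (hs : s ∈ 𝓝 (extChartAt (𝓡 3) p q)) (hh : ContDiffOn ℝ ∞ h s) :
    ∃ f : CF M, ∀ᶠ q' in 𝓝 q, f q' = h (extChartAt (𝓡 3) p q') :=
  exists_contMDiffMap_eventuallyEq
    (inter_mem ((isOpen_extChartAt_source p).mem_nhds hq) ((continuousAt_extChartAt' hq) hs))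
    (contMDiffOn_comp_extChartAt hh)

variable (b : SmoothBumpFunction (𝓡 3) p)

/-- The vector field `v` of the chart at `p`, cut off outside of the chart. -/
def chartVec (v : EuclideanSpace ℝ (Fin 3)) : Vec M :=
  Derivation.mk'
    { toFun := fun f => ⟨fun q => b q • chartDeriv p v f q, b.contMDiff_smul (by
        rw [← extChartAt_source (𝓡 3)]
        exact contMDiffOn_chartDeriv p v f)⟩
      map_add' := fun f g => by
        ext q
        exact (bump_smul_congr (b := b) (chartDeriv_add v f g)).trans (smul_add _ _ _)
      map_smul' := fun c f => by
        ext q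
        exact (bump_smul_congr (b := b) (chartDeriv_smul v c f)).trans (mul_smul_comm _ _ _).symm }
    (fun f g => by
      ext q
      refine (bump_smul_congr (b := b) (chartDeriv_mul v f g)).trans ?_
      rw [smul_add, ← mul_smul_comm, ← mul_smul_comm]
      rfl)

/-- The coordinate vector fields of the chart at `p`. -/
def coordVec (i : Fin 3) : Vec M := chartVec b (EuclideanSpace.single i 1)

/-- The coordinate functions of the chart at `p`, cut off outside of the chart. -/
def coord (i : Fin 3) : CF M :=
  ⟨fun q => b q • ((extChartAt (𝓡 3) p q i : ℝ) : ℂ), b.contMDiff_smul (by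
    rw [← extChartAt_source (𝓡 3)]
    have smooth : ContDiffOn ℝ ∞ (fun y : EuclideanSpace ℝ (Fin 3) => ((y i : ℝ) : ℂ)) Set.univ :=
      (Complex.ofRealCLM.contDiff.comp (EuclideanSpace.proj i).contDiff).contDiffOn
    simpa using contMDiffOn_comp_extChartAt (p := p) smooth)⟩

variable {b}

theorem coord_apply (hq : q ∈ coordDomain b) (i : Fin 3) :
    coord b i q = (extChartAt (𝓡 3) p q i : ℝ) := by
  change b q • ((extChartAt (𝓡 3) p q i : ℝ) : ℂ) = _
  rw [bump_eq_one hq, one_smul]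

theorem coordVec_apply (hq : q ∈ coordDomain b) (i : Fin 3) (f : CF M) :
    coordVec b i f q = chartDeriv p (EuclideanSpace.single i 1) f q := by
  change b q • chartDeriv p (EuclideanSpace.single i 1) f q = _
  rw [bump_eq_one hq, one_smul]

theorem coordVec_coord (hq : q ∈ coordDomain b) (i j : Fin 3) :
    coordVec b i (coord b j) q = if j = i then 1 else 0 := by
  have linear : ∀ᶠ q' in 𝓝 q, coord b j q' =
      Complex.ofRealCLM.comp (EuclideanSpace.proj j) (extChartAt (𝓡 3) p q') :=
    eventually_of_mem (isOpen_coordDomain.mem_nhds hq) fun q' hq' => coord_apply hq' j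
  rw [coordVec_apply hq, chartDeriv_eq_fderiv _ (coordDomain_subset_source hq) linear,
    ContinuousLinearMap.fderiv]
  simp [apply_ite Complex.ofReal]

theorem exists_eventuallyEq_add_sum_coord (hq : q ∈ coordDomain b) (f : CF M) :
    ∃ G : Fin 3 → CF M, (∀ i, G i q = coordVec b i f q) ∧
      f =ᶠ[𝓝 q] (algebraMap ℂ (CF M) (f q) +
        ∑ i, (coord b i - algebraMap ℂ (CF M) (coord b i q)) * G i : CF M) := by
  have hs := coordDomain_subset_source hq
  obtain ⟨h, hh, hfh⟩ := f.exists_contDiff_eventuallyEq hs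
  obtain ⟨g, hg, hga, hgy⟩ := exists_hadamard_quotients hh (extChartAt (𝓡 3) p q)
  choose G hG using fun i => exists_eventuallyEq_comp_extChartAt hs univ_mem (hg i).contDiffOn
  refine ⟨G, fun i => ?_, ?_⟩
  · rw [(hG i).self_of_nhds, hga, coordVec_apply hq, chartDeriv_eq_fderiv _ hs hfh]
  · filter_upwards [hfh, eventually_all.2 hG, isOpen_coordDomain.mem_nhds hq] with q' hfq' hGq' hq'
    rw [hfq', hgy, ← hfh.self_of_nhds]
    simp [coord_apply hq, coord_apply hq', hGq']

theorem Vec.apply_eq_sum_coord (V : Vec M) (f : CF M) (hq : q ∈ coordDomain b) :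
    V f q = ∑ i, V (coord b i) q * coordVec b i f q := by
  obtain ⟨G, hG, hf⟩ := exists_eventuallyEq_add_sum_coord hq f
  rw [V.apply_congr hf, map_add, Derivation.map_algebraMap, zero_add, map_sum, CF.sum_apply]
  refine Finset.sum_congr rfl fun i _ => ?_
  simp [Derivation.leibniz, hG, mul_comm]

theorem exists_coordVec_eq (a : Fin 3 → CF M)
    (ha : ∀ᶠ q in 𝓝 p, ∀ i j, coordVec b i (a j) q = coordVec b j (a i) q) :
    ∃ G : CF M, ∀ᶠ q in 𝓝 p, ∀ i, coordVec b i G q = a i q := by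
  set φ := extChartAt (𝓡 3) p with hφ
  have hp : p ∈ φ.source := mem_extChartAt_source p
  have hD : ∀ᶠ q in 𝓝 p, q ∈ coordDomain b := isOpen_coordDomain.mem_nhds mem_coordDomain
  have tendsto : Tendsto φ.symm (𝓝 (φ p)) (𝓝 p) := by
    simpa only [ContinuousAt, hφ, extChartAt_to_inv] using
      continuousAt_extChartAt_symm (I := 𝓡 3) p
  obtain ⟨r, hr, hB⟩ := Metric.eventually_nhds_iff_ball.1 ((tendsto.eventually (ha.and hD)).and
    ((isOpen_extChartAt_target p).mem_nhds (φ.map_source hp)))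
  have closed : ∀ y ∈ Metric.ball (φ p) r, ∀ i j,
      fderiv ℝ (a j ∘ φ.symm) y (EuclideanSpace.single i 1) =
        fderiv ℝ (a i ∘ φ.symm) y (EuclideanSpace.single j 1) := fun y hy i j => by
    obtain ⟨⟨symm, hyD⟩, hyt⟩ := hB y hy
    simpa only [coordVec_apply hyD, chartDeriv, ← hφ, φ.right_inv hyt] using symm i j
  obtain ⟨G, hG, hGa⟩ := exists_primitive_of_fderiv_symmetric (convex_ball (φ p) r)
    Metric.isOpen_ball (fun i => ((a i).contDiffOn_comp_extChartAt_symm p).mono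
      fun y hy => (hB y hy).2) closed
  have ball_mem : Metric.ball (φ p) r ∈ 𝓝 (φ p) := Metric.ball_mem_nhds _ hr
  obtain ⟨G', hG'⟩ := exists_eventuallyEq_comp_extChartAt hp ball_mem hG
  refine ⟨G', ?_⟩
  filter_upwards [hG'.eventually_nhds, continuousAt_extChartAt p ball_mem, hD] with q hqG hqB hqD i
  rw [coordVec_apply hqD, chartDeriv_eq_fderiv _ (coordDomain_subset_source hqD) hqG, hGa _ hqB,
    Function.comp_apply, φ.left_inv (coordDomain_subset_source hqD)]

end Charts

section Tensors

variable {M : Type*} [TopologicalSpace M] [ChartedSpace (EuclideanSpace ℝ (Fin 3)) M]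

theorem conjV_conjV (V : Vec M) : conjV (conjV V) = V := by
  ext1 f
  simp only [conjV_apply, conjF_conjF]

theorem conjV_smul (b : CF M) (V : Vec M) : conjV (b • V) = conjF b • conjV V := by
  ext1 f
  simp only [conjV_apply, Derivation.smul_apply, smul_eq_mul, map_mul]

theorem conjV_lie (V W : Vec M) : conjV ⁅V, W⁆ = ⁅conjV V, conjV W⁆ := by
  ext1 f
  simp only [conjV_apply, Derivation.commutator_apply, map_sub, conjF_conjF]

theorem smul_lie_vec (f : CF M) (V W : Vec M) : ⁅f • V, W⁆ = f • ⁅V, W⁆ - W f • V := by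
  ext1 g
  simp only [Derivation.commutator_apply, Derivation.smul_apply, smul_eq_mul, Derivation.leibniz,
    Derivation.sub_apply]
  ring

theorem conjForm_apply (α : Form1 M) (V : Vec M) : conjForm α V = conjF (α (conjV V)) := rfl

theorem wedge_apply (α β : Form1 M) (V W : Vec M) (p : M) :
    wedge α β V W p = α V p * β W p - α W p * β V p := by
  simp only [wedge, LinearMap.sub_apply, LinearMap.smulRight_apply, LinearMap.smul_apply,
    smul_eq_mul, CF.sub_apply, CF.mul_apply]
  ring

theorem dForm_swap (α : Form1 M) (V W : Vec M) : dForm α W V = -dForm α V W := by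
  rw [dForm, dForm, ← lie_skew, map_neg]
  ring

theorem dForm_self (α : Form1 M) (V : Vec M) : dForm α V V = 0 := by
  rw [dForm, lie_self, map_zero, sub_self, sub_zero]

theorem dForm_add_left (α : Form1 M) (V V' W : Vec M) :
    dForm α (V + V') W = dForm α V W + dForm α V' W := by
  simp only [dForm, Derivation.add_apply, map_add, add_lie]
  ring

theorem dForm_smul_left (α : Form1 M) (f : CF M) (V W : Vec M) :
    dForm α (f • V) W = f * dForm α V W := by
  simp only [dForm, smul_lie_vec, Derivation.smul_apply, smul_eq_mul, map_smul, map_sub,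
    Derivation.leibniz]
  ring

/-- The exterior derivative of a `1`-form, as a bilinear map. -/
def extDeriv (α : Form1 M) : Form2 M :=
  LinearMap.mk₂ (CF M) (dForm α) (dForm_add_left α) (dForm_smul_left α)
    (fun V W W' => by
      rw [dForm_swap α (W + W') V, dForm_add_left, dForm_swap α W V, dForm_swap α W' V, neg_add])
    (fun f V W => by
      rw [dForm_swap α (f • W) V, dForm_smul_left, dForm_swap α W V, smul_eq_mul, mul_neg])

theorem extDeriv_apply (α : Form1 M) (V W : Vec M) : extDeriv α V W = dForm α V W := rfl

/-- The exterior derivative `V ↦ V f` of a function. -/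
def differential (f : CF M) : Form1 M where
  toFun V := V f
  map_add' _ _ := rfl
  map_smul' _ _ := rfl

theorem differential_apply (f : CF M) (V : Vec M) : differential f V = V f := rfl

theorem dForm_differential (f : CF M) (V W : Vec M) : dForm (differential f) V W = 0 := by
  simp only [dForm, differential_apply, Derivation.commutator_apply, sub_self]

theorem dForm_sub (α β : Form1 M) (V W : Vec M) :
    dForm (α - β) V W = dForm α V W - dForm β V W := by
  simp only [dForm, LinearMap.sub_apply, map_sub]
  ring

theorem dForm_conjV (α : Form1 M) (V W : Vec M) :
    dForm α (conjV V) (conjV W) = conjF (dForm (conjForm α) V W) := by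
  simp only [dForm, conjForm_apply, map_sub, conjF_conjF, conjV_lie, conjV_apply]

theorem dForm_cyclic (α : Form1 M) (X Y Z : Vec M) :
    X (dForm α Y Z) - Y (dForm α X Z) + Z (dForm α X Y)
      - dForm α ⁅X, Y⁆ Z + dForm α ⁅X, Z⁆ Y - dForm α ⁅Y, Z⁆ X = 0 := by
  have jacobi : α ⁅⁅X, Y⁆, Z⁆ - α ⁅⁅X, Z⁆, Y⁆ + α ⁅⁅Y, Z⁆, X⁆ = 0 := by
    have : ⁅⁅X, Y⁆, Z⁆ - ⁅⁅X, Z⁆, Y⁆ + ⁅⁅Y, Z⁆, X⁆ = 0 := by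
      ext1 f
      simp only [Derivation.commutator_apply, Derivation.add_apply, Derivation.sub_apply,
        Derivation.zero_apply, map_sub]
      ring
    rw [← map_sub, ← map_add, this, map_zero]
  simp only [dForm, map_sub, Derivation.commutator_apply]
  linear_combination jacobi

variable [T2Space M] [IsManifold (𝓡 3) ∞ M] {p : M}

theorem Vec.apply_eq_zero_of_const (V : Vec M) {f : CF M} {c : ℂ} {U : Set M} (hU : IsOpen U)
    (h : ∀ q ∈ U, f q = c) (hp : p ∈ U) : V f p = 0 := by
  rw [V.congr_on hU (g := algebraMap ℂ (CF M) c) h hp, Derivation.map_algebraMap, CF.zero_apply]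

theorem dForm_eq_neg_of_const {α : Form1 M} {V W : Vec M} {a b : ℂ} {U : Set M} (hU : IsOpen U)
    (hV : ∀ q ∈ U, α V q = a) (hW : ∀ q ∈ U, α W q = b) (hp : p ∈ U) :
    dForm α V W p = -α ⁅V, W⁆ p := by
  simp only [dForm, CF.sub_apply, V.apply_eq_zero_of_const hU hW hp,
    W.apply_eq_zero_of_const hU hV hp]
  ring

theorem form_apply_eq_sum_coord {b : SmoothBumpFunction (𝓡 3) p} {q : M}
    (hq : q ∈ coordDomain b) (α : Form1 M) (V : Vec M) :
    α V q = ∑ i, V (coord b i) q * α (coordVec b i) q := by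
  obtain ⟨χ, hχ1, hχ0⟩ := exists_bump (isOpen_coordDomain.mem_nhds hq)
  have cutoff : χ • V = ∑ i, (χ * V (coord b i)) • coordVec b i := by
    ext f q'
    rw [Fin.sum_univ_three]
    simp only [Derivation.add_apply, Derivation.smul_apply, smul_eq_mul, CF.add_apply,
      CF.mul_apply]
    by_cases hq' : q' ∈ coordDomain b
    · rw [V.apply_eq_sum_coord f hq', Fin.sum_univ_three]
      ring
    · simp [hχ0 q' hq']
  simpa [hχ1.self_of_nhds] using congrArg (fun W => α W q) cutoff

theorem form_congr_at (α : Form1 M) {V W : Vec M} (h : ∀ f, V f p = W f p) :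
    α V p = α W p := by
  obtain ⟨b⟩ : Nonempty (SmoothBumpFunction (𝓡 3) p) := inferInstance
  have hp := mem_coordDomain (b := b)
  rw [form_apply_eq_sum_coord hp α V, form_apply_eq_sum_coord hp α W]
  simp only [h]

theorem dForm_congr_at (α : Form1 M) {V V' W W' : Vec M} (h : ∀ f, V f p = V' f p)
    (h' : ∀ f, W f p = W' f p) : dForm α V W p = dForm α V' W' p := by
  rw [← extDeriv_apply, ← extDeriv_apply, form_congr_at (extDeriv α V) h']
  exact form_congr_at ((extDeriv α).flip W') h

open Matrix in
theorem Vec.apply_eq_sum_of_dual (α : Fin 3 → Form1 M) (e : Fin 3 → Vec M)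
    (dual : ∀ i j, α i (e j) p = if i = j then 1 else 0) (V : Vec M) (f : CF M) :
    V f p = ∑ i, α i V p * e i f p := by
  obtain ⟨b⟩ : Nonempty (SmoothBumpFunction (𝓡 3) p) := inferInstance
  have hp := mem_coordDomain (b := b)
  let A : Matrix (Fin 3) (Fin 3) ℂ := of fun i k => α i (coordVec b k) p
  let B : Matrix (Fin 3) (Fin 3) ℂ := of fun k j => e j (coord b k) p
  let v : Fin 3 → ℂ := fun k => V (coord b k) p
  let df : Fin 3 → ℂ := fun k => coordVec b k f p
  have hAB : A * B = 1 := by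
    ext i j
    rw [mul_apply, one_apply, ← dual i j, form_apply_eq_sum_coord hp]
    exact Finset.sum_congr rfl fun k _ => mul_comm _ _
  have hv (i) : α i V p = (A *ᵥ v) i := by
    rw [form_apply_eq_sum_coord hp]
    exact Finset.sum_congr rfl fun k _ => mul_comm _ _
  have he (i) : e i f p = (df ᵥ* B) i := by
    rw [(e i).apply_eq_sum_coord f hp]
    exact Finset.sum_congr rfl fun k _ => mul_comm _ _
  calc V f p = v ⬝ᵥ df := V.apply_eq_sum_coord f hp
    _ = A *ᵥ v ⬝ᵥ df ᵥ* B := by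
      rw [dotProduct_comm (A *ᵥ v), ← dotProduct_mulVec, mulVec_mulVec, mul_eq_one_comm.1 hAB,
        one_mulVec, dotProduct_comm]
    _ = ∑ i, α i V p * e i f p := by simp only [hv, he, dotProduct]

theorem form_apply_eq_sum_of_dual (α : Fin 3 → Form1 M) (e : Fin 3 → Vec M)
    (dual : ∀ i j, α i (e j) p = if i = j then 1 else 0) (β : Form1 M) (V : Vec M) :
    β V p = ∑ i, α i V p * β (e i) p := by
  have expansion (f : CF M) : V f p = (∑ i, α i V • e i : Vec M) f p := by
    rw [Vec.apply_eq_sum_of_dual α e dual V f, Fin.sum_univ_three, Fin.sum_univ_three]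
    rfl
  rw [form_congr_at β expansion]
  simp only [map_sum, map_smul, smul_eq_mul, CF.sum_apply, CF.mul_apply]

theorem dForm_congr_form {α β : Form1 M} {U : Set M} (hU : IsOpen U)
    (h : ∀ q ∈ U, ∀ V, α V q = β V q) (hp : p ∈ U) (V W : Vec M) :
    dForm α V W p = dForm β V W p := by
  simp only [dForm, CF.sub_apply, h p hp, V.congr_on hU (fun q hq => h q hq W) hp,
    W.congr_on hU (fun q hq => h q hq V) hp]

theorem coordVec_comm {b : SmoothBumpFunction (𝓡 3) p} {q : M} (hq : q ∈ coordDomain b)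
    (i j : Fin 3) (α : Form1 M) : α ⁅coordVec b i, coordVec b j⁆ q = 0 := by
  have deriv_const (i j k) : coordVec b i (coordVec b j (coord b k)) q = 0 :=
    (coordVec b i).apply_eq_zero_of_const isOpen_coordDomain
      (fun q' hq' => coordVec_coord hq' j k) hq
  rw [form_apply_eq_sum_coord hq]
  simp [Derivation.commutator_apply, deriv_const]

theorem exists_primitive_of_dForm_eq_zero {α : Form1 M}
    (closed : ∀ᶠ q in 𝓝 p, ∀ V W, dForm α V W q = 0) :
    ∃ G : CF M, ∀ᶠ q in 𝓝 p, ∀ V : Vec M, V G q = α V q := by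
  obtain ⟨b⟩ : Nonempty (SmoothBumpFunction (𝓡 3) p) := inferInstance
  have hD : ∀ᶠ q in 𝓝 p, q ∈ coordDomain b := isOpen_coordDomain.mem_nhds mem_coordDomain
  obtain ⟨G, hG⟩ := exists_coordVec_eq (fun i => α (coordVec b i)) (b := b) (by
    filter_upwards [closed, hD] with q hqc hqD i j
    have := hqc (coordVec b i) (coordVec b j)
    simpa only [dForm, CF.sub_apply, coordVec_comm hqD i j α, sub_zero, sub_eq_zero] using this)
  refine ⟨G, ?_⟩
  filter_upwards [hG, hD] with q hqG hqD V
  rw [V.apply_eq_sum_coord G hqD, form_apply_eq_sum_coord hqD]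
  simp only [hqG]

end Tensors

section Frames

variable {M : Type*} [TopologicalSpace M] [ChartedSpace (EuclideanSpace ℝ (Fin 3)) M]

namespace Pseudohermitian

variable (S : Pseudohermitian M)

theorem mem_T10_iff {V : Vec M} :
    V ∈ S.T10 ↔ ∃ h : S.θ V = 0, S.J ⟨V, h⟩ = algebraMap ℂ (CF M) Complex.I • ⟨V, h⟩ := by
  rw [T10, Submodule.mem_map]
  constructor
  · rintro ⟨W, hW, rfl⟩
    exact ⟨W.2, sub_eq_zero.1 hW⟩
  · rintro ⟨h, hJ⟩
    exact ⟨⟨V, h⟩, sub_eq_zero.2 hJ, rfl⟩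

theorem θ_conjV (V : Vec M) : S.θ (conjV V) = conjF (S.θ V) := by
  conv_lhs => rw [← S.θ_real, conjForm_apply, conjV_conjV]

theorem θ_eq_zero {V : Vec M} (h : V ∈ S.T10) : S.θ V = 0 := (S.mem_T10_iff.1 h).1

theorem θ_conjV_eq_zero {V : Vec M} (h : V ∈ S.T10) : S.θ (conjV V) = 0 := by
  rw [θ_conjV, S.θ_eq_zero h, map_zero]

theorem dForm_θ_conjV (V W : Vec M) :
    dForm S.θ (conjV V) (conjV W) = conjF (dForm S.θ V W) := by
  rw [dForm_conjV, S.θ_real]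

theorem J_conjV {V : Vec M} (h : V ∈ S.T10) :
    S.J ⟨conjV V, S.θ_conjV_eq_zero h⟩ =
      -(algebraMap ℂ (CF M) Complex.I • ⟨conjV V, S.θ_conjV_eq_zero h⟩) := by
  obtain ⟨hθ, hJ⟩ := S.mem_T10_iff.1 h
  have conj_I : conjF (algebraMap ℂ (CF M) Complex.I) = -algebraMap ℂ (CF M) Complex.I := by
    ext q
    simp
  apply Subtype.ext
  rw [S.J_real ⟨V, hθ⟩ _ rfl, hJ, Submodule.coe_smul, conjV_smul, conj_I, neg_smul,
    Submodule.coe_neg, Submodule.coe_smul]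

theorem sub_I_J_mem_T10 (V : LinearMap.ker S.θ) :
    ((V - algebraMap ℂ (CF M) Complex.I • S.J V : LinearMap.ker S.θ) : Vec M) ∈ S.T10 := by
  have I_sq : algebraMap ℂ (CF M) Complex.I * algebraMap ℂ (CF M) Complex.I = -1 := by
    rw [← map_mul, Complex.I_mul_I, map_neg, map_one]
  rw [mem_T10_iff]
  refine ⟨(V - algebraMap ℂ (CF M) Complex.I • S.J V : LinearMap.ker S.θ).2, ?_⟩
  rw [Subtype.coe_eta, map_sub, map_smul, S.J_sq, smul_sub, smul_smul, I_sq, smul_neg, neg_one_smul]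
  abel

theorem conjF_levi (Z : Vec M) :
    conjF ((-Complex.I) • dForm S.θ Z (conjV Z)) = (-Complex.I) • dForm S.θ Z (conjV Z) := by
  rw [conjF_smul, ← S.dForm_θ_conjV, conjV_conjV, dForm_swap, map_neg, Complex.conj_I, smul_neg,
    neg_neg, neg_smul]

/-- The coframe `{θ, θ1, conj θ1}` is dual to the frame `{T, Z, conj Z}` at `p`. -/
structure IsDualAt (T Z : Vec M) (θ1 : Form1 M) (p : M) : Prop where
  θ_T : S.θ T p = 1
  θ_Z : S.θ Z p = 0
  θ1_T : θ1 T p = 0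
  θ1_Z : θ1 Z p = 1
  θ1_Zbar : θ1 (conjV Z) p = 0
  conjForm_θ1_T : conjForm θ1 T p = 0

namespace IsDualAt

variable {S} {T Z : Vec M} {θ1 : Form1 M} {p : M}

theorem θ_Zbar (h : S.IsDualAt T Z θ1 p) : S.θ (conjV Z) p = 0 := by
  rw [θ_conjV, conjF_apply, h.θ_Z, map_zero]

theorem conjForm_θ1_Z (h : S.IsDualAt T Z θ1 p) : conjForm θ1 Z p = 0 := by
  rw [conjForm_apply, conjF_apply, h.θ1_Zbar, map_zero]

theorem conjForm_θ1_Zbar (h : S.IsDualAt T Z θ1 p) : conjForm θ1 (conjV Z) p = 1 := by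
  rw [conjForm_apply, conjF_apply, conjV_conjV, h.θ1_Z, map_one]

variable [T2Space M] [IsManifold (𝓡 3) ∞ M]

theorem form_expand (h : S.IsDualAt T Z θ1 p) (α : Form1 M) (V : Vec M) :
    α V p = S.θ V p * α T p + θ1 V p * α Z p + conjForm θ1 V p * α (conjV Z) p := by
  have expansion := form_apply_eq_sum_of_dual (p := p) ![S.θ, θ1, conjForm θ1] ![T, Z, conjV Z]
    (by
      intro i j
      fin_cases i <;> fin_cases j <;>
        simp [h.θ_T, h.θ_Z, h.θ_Zbar, h.θ1_T, h.θ1_Z, h.θ1_Zbar, h.conjForm_θ1_T,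
          h.conjForm_θ1_Z, h.conjForm_θ1_Zbar]) α V
  simpa [Fin.sum_univ_three] using expansion

theorem vec_expand (h : S.IsDualAt T Z θ1 p) (V : Vec M) (f : CF M) :
    V f p = S.θ V p * T f p + θ1 V p * Z f p + conjForm θ1 V p * conjV Z f p :=
  h.form_expand (differential f) V

theorem dForm_expand (h : S.IsDualAt T Z θ1 p) (α : Form1 M) (V W : Vec M) :
    dForm α V W p = wedge S.θ θ1 V W p * dForm α T Z p +
      wedge S.θ (conjForm θ1) V W p * dForm α T (conjV Z) p +
      wedge θ1 (conjForm θ1) V W p * dForm α Z (conjV Z) p := by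
  have expand (X Y : Vec M) := h.form_expand (extDeriv α X) Y
  have swap (X Y : Vec M) : dForm α X Y p = -dForm α Y X p := by rw [dForm_swap α Y X, CF.neg_apply]
  simp only [extDeriv_apply] at expand
  rw [expand V W, swap V T, swap V Z, swap V (conjV Z), expand T V, expand Z V,
    expand (conjV Z) V, swap Z T, swap (conjV Z) T, swap (conjV Z) Z, dForm_self, dForm_self,
    dForm_self, wedge_apply, wedge_apply, wedge_apply, CF.zero_apply]
  ring

theorem conjV_T (h : S.IsDualAt T Z θ1 p) (f : CF M) : conjV T f p = T f p := by
  have θ1_conjV_T : θ1 (conjV T) p = 0 := by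
    simpa only [conjForm_apply, conjF_apply, map_eq_zero] using h.conjForm_θ1_T
  rw [h.vec_expand, conjForm_apply, conjV_conjV, conjF_apply, h.θ1_T, θ1_conjV_T, S.θ_conjV,
    conjF_apply, h.θ_T]
  simp

end IsDualAt

namespace LocalFrame

variable {S} (F : S.LocalFrame)

theorem conjV_Z : conjV F.Z = F.Zbar := rfl

theorem conjV_Zbar : conjV F.Zbar = F.Z := conjV_conjV _

theorem θ_Z : S.θ F.Z = 0 := S.θ_eq_zero F.Z_mem

theorem θ_Zbar : S.θ F.Zbar = 0 := S.θ_conjV_eq_zero F.Z_mem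

variable {F} {p : M}

theorem isDualAt (hp : p ∈ F.U) : S.IsDualAt F.T F.Z F.θ1 p where
  θ_T := F.θ_T p hp
  θ_Z := by rw [F.θ_Z, CF.zero_apply]
  θ1_T := F.θ1_T p hp
  θ1_Z := F.θ1_Z p hp
  θ1_Zbar := F.θ1_Zbar p hp
  conjForm_θ1_T := by
    simpa [F.dθ_T p hp, wedge_apply, F.θ1_T p hp, F.θ1_Z p hp] using F.levi p hp F.T F.Z

theorem conj_conn_Zbar (hp : p ∈ F.U) : (starRingEnd ℂ) (F.conn F.Zbar p) = -F.conn F.Z p := by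
  have skew := F.skew p hp F.Z
  rw [CF.add_apply, conjForm_apply, conjF_apply, conjV_Z] at skew
  linear_combination skew

theorem θ_lie_Z_Zbar (hp : p ∈ F.U) : S.θ ⁅F.Z, F.Zbar⁆ p = -Complex.I := by
  have levi := F.levi p hp F.Z (conjV F.Z)
  rw [dForm, conjV_Z, F.θ_Z, F.θ_Zbar, map_zero, map_zero, sub_zero, zero_sub,
    CF.neg_apply, wedge_apply, ← conjV_Z, F.θ1_Z p hp, (isDualAt hp).conjForm_θ1_Zbar,
    (isDualAt hp).conjForm_θ1_Z, conjV_Z] at levi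
  linear_combination -levi

variable [T2Space M] [IsManifold (𝓡 3) ∞ M]

theorem form_expand (hp : p ∈ F.U) (α : Form1 M) (V : Vec M) :
    α V p = S.θ V p * α F.T p + F.θ1 V p * α F.Z p + conjForm F.θ1 V p * α F.Zbar p :=
  (isDualAt hp).form_expand α V

theorem dForm_θ1_eq_neg (hp : p ∈ F.U) {V W : Vec M} {a b : ℂ} (hV : ∀ q ∈ F.U, F.θ1 V q = a)
    (hW : ∀ q ∈ F.U, F.θ1 W q = b) :
    wedge F.θ1 F.conn V W p + F.torsion p * wedge S.θ (conjForm F.θ1) V W p =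
      -F.θ1 ⁅V, W⁆ p := by
  rw [← F.struct_eq p hp, dForm_eq_neg_of_const F.isOpen hV hW hp]

theorem θ_lie_T_Z (hp : p ∈ F.U) : S.θ ⁅F.T, F.Z⁆ p = 0 := by
  have reeb := F.dθ_T p hp F.Z
  rw [dForm_eq_neg_of_const F.isOpen F.θ_T (fun q hq => (isDualAt hq).θ_Z) hp] at reeb
  linear_combination -reeb

theorem θ1_lie_Z_Zbar (hp : p ∈ F.U) : F.θ1 ⁅F.Z, F.Zbar⁆ p = -F.conn F.Zbar p := by
  have struct := dForm_θ1_eq_neg hp F.θ1_Z F.θ1_Zbar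
  rw [wedge_apply, wedge_apply, F.θ1_Z p hp, F.θ1_Zbar p hp, (isDualAt hp).θ_Z,
    (isDualAt hp).θ_Zbar, conjV_Z] at struct
  linear_combination struct

theorem θ1_lie_T_Z (hp : p ∈ F.U) : F.θ1 ⁅F.T, F.Z⁆ p = F.conn F.T p := by
  have struct := dForm_θ1_eq_neg hp F.θ1_T F.θ1_Z
  rw [wedge_apply, wedge_apply, F.θ1_T p hp, F.θ1_Z p hp, (isDualAt hp).θ_Z,
    (isDualAt hp).conjForm_θ1_Z] at struct
  linear_combination struct

theorem θ1_lie_T_Zbar (hp : p ∈ F.U) : F.θ1 ⁅F.T, F.Zbar⁆ p = -F.torsion p := by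
  have struct := dForm_θ1_eq_neg hp F.θ1_T F.θ1_Zbar
  rw [wedge_apply, wedge_apply, F.θ1_T p hp, F.θ1_Zbar p hp, F.θ_T p hp,
    (isDualAt hp).θ_Zbar, (isDualAt hp).conjForm_θ1_Zbar, conjV_Z] at struct
  linear_combination struct

theorem conjForm_θ1_lie_Z_Zbar (hp : p ∈ F.U) :
    conjForm F.θ1 ⁅F.Z, F.Zbar⁆ p = -F.conn F.Z p := by
  rw [conjForm_apply, conjV_lie, conjV_Zbar, conjV_Z, ← lie_skew, map_neg, conjF_apply,
    CF.neg_apply, θ1_lie_Z_Zbar hp, neg_neg, conj_conn_Zbar hp]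

theorem conjForm_θ1_lie_T_Z (hp : p ∈ F.U) : conjForm F.θ1 ⁅F.T, F.Z⁆ p = -F.A11 p := by
  have lie_conjV_T (f : CF M) : ⁅conjV F.T, F.Zbar⁆ f p = ⁅F.T, F.Zbar⁆ f p := by
    simp only [Derivation.commutator_apply, CF.sub_apply, (isDualAt hp).conjV_T,
      F.Zbar.congr_on F.isOpen (fun _ hq => (isDualAt hq).conjV_T f) hp]
  rw [conjForm_apply, conjV_lie, conjV_Z, conjF_apply, form_congr_at F.θ1 lie_conjV_T,
    θ1_lie_T_Zbar hp, map_neg]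
  rfl

theorem form_lie_Z_Zbar (hp : p ∈ F.U) (α : Form1 M) : α ⁅F.Z, F.Zbar⁆ p =
    -Complex.I * α F.T p - F.conn F.Zbar p * α F.Z p - F.conn F.Z p * α F.Zbar p := by
  rw [form_expand hp, θ_lie_Z_Zbar hp, θ1_lie_Z_Zbar hp, conjForm_θ1_lie_Z_Zbar hp]
  ring

theorem form_lie_T_Z (hp : p ∈ F.U) (α : Form1 M) :
    α ⁅F.T, F.Z⁆ p = F.conn F.T p * α F.Z p - F.A11 p * α F.Zbar p := by
  rw [form_expand hp, θ_lie_T_Z hp, θ1_lie_T_Z hp, conjForm_θ1_lie_T_Z hp]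
  ring

theorem conjForm_θ1_eq_zero (hp : p ∈ F.U) {V : Vec M} (hV : V ∈ S.T10) :
    conjForm F.θ1 V p = 0 := by
  obtain ⟨χ, hχ1, hχ0⟩ := exists_bump (F.isOpen.mem_nhds hp)
  obtain ⟨hθ, hJ⟩ := S.mem_T10_iff.1 hV
  obtain ⟨hθZ, hJZ⟩ := S.mem_T10_iff.1 F.Z_mem
  let Zbar : LinearMap.ker S.θ := ⟨F.Zbar, F.θ_Zbar⟩
  have hJZbar : S.J Zbar = -(algebraMap ℂ (CF M) Complex.I • Zbar) := S.J_conjV F.Z_mem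
  have cutoff : χ • (⟨V, hθ⟩ : LinearMap.ker S.θ) =
      (χ * F.θ1 V) • ⟨F.Z, hθZ⟩ + (χ * conjForm F.θ1 V) • Zbar := by
    apply Subtype.ext
    ext f q
    change χ q * V f q = χ q * F.θ1 V q * F.Z f q + χ q * conjForm F.θ1 V q * conjV F.Z f q
    by_cases hq : q ∈ F.U
    · rw [(isDualAt hq).vec_expand V f, hθ, CF.zero_apply]
      ring
    · simp [hχ0 q hq]
  have eigen := congrArg (fun W => conjForm F.θ1 (S.J W : Vec M) p) cutoff
  have conjForm_θ1_Zbar : conjForm F.θ1 F.Zbar p = 1 := (isDualAt hp).conjForm_θ1_Zbar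
  simp only [map_smul, map_add, hJ, hJZ, hJZbar, Zbar, Submodule.coe_smul, Submodule.coe_add,
    Submodule.coe_neg, map_neg, smul_eq_mul, CF.add_apply, CF.mul_apply, CF.neg_apply,
    CF.algebraMap_apply, (isDualAt hp).conjForm_θ1_Z, conjForm_θ1_Zbar, hχ1.self_of_nhds] at eigen
  have : (2 * Complex.I) * conjForm F.θ1 V p = 0 := by linear_combination eigen
  simpa using this

theorem vec_eq_mul_Z (hp : p ∈ F.U) {V : Vec M} (hV : V ∈ S.T10) (f : CF M) :
    V f p = F.θ1 V p * F.Z f p := by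
  rw [(isDualAt hp).vec_expand V f, S.θ_eq_zero hV, conjForm_θ1_eq_zero hp hV]
  simp

end LocalFrame

end Pseudohermitian

end Frames

section SmoothFunctions

variable {M : Type*} [TopologicalSpace M] [ChartedSpace (EuclideanSpace ℝ (Fin 3)) M]
  [T2Space M] [IsManifold (𝓡 3) ∞ M] {f : CF M} {p : M}

theorem exists_eventually_eq_comp {φ : ℂ → ℂ} {s : Set ℂ} (hs : IsOpen s)
    (hφ : ContDiffOn ℝ ∞ φ s) (hp : f p ∈ s) : ∃ g : CF M, ∀ᶠ q in 𝓝 p, g q = φ (f q) :=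
  exists_contMDiffMap_eventuallyEq
    (f.contMDiff.continuous.continuousAt.preimage_mem_nhds (hs.mem_nhds hp))
    (hφ.contMDiffOn.comp f.contMDiff.contMDiffOn fun _ hq => hq)

theorem exists_mul_conj_mul_eq_one (real : conjF f = f) (pos : 0 < (f p).re) :
    ∃ r : CF M, ∀ᶠ q in 𝓝 p, r q * conjF r q * f q = 1 := by
  have re_eq (q : M) : ((f q).re : ℂ) = f q :=
    Complex.conj_eq_iff_re.1 (congrArg (fun g : CF M => g q) real)
  have isOpen_pos : IsOpen {z : ℂ | 0 < z.re} := isOpen_lt continuous_const Complex.continuous_re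
  have smooth : ContDiffOn ℝ ∞ (fun z : ℂ => (((√z.re)⁻¹ : ℝ) : ℂ)) {z | 0 < z.re} := fun z hz =>
    (Complex.ofRealCLM.contDiff.contDiffAt.comp z
      ((Complex.reCLM.contDiff.contDiffAt.sqrt (ne_of_gt hz)).inv
        (Real.sqrt_pos.2 hz).ne')).contDiffWithinAt
  obtain ⟨r, hr⟩ := exists_eventually_eq_comp isOpen_pos smooth pos
  refine ⟨r, ?_⟩
  filter_upwards [hr, f.contMDiff.continuous.continuousAt.eventually
    (isOpen_pos.mem_nhds pos)] with q hrq hq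
  have sq : √(f q).re * √(f q).re = (f q).re := Real.mul_self_sqrt (le_of_lt hq)
  have cancel : (√(f q).re)⁻¹ * (√(f q).re)⁻¹ * (f q).re = 1 := by
    rw [← mul_inv, sq, inv_mul_cancel₀ (ne_of_gt hq)]
  rw [conjF_apply, hrq, Complex.conj_ofReal, ← re_eq q]
  exact_mod_cast cancel

end SmoothFunctions

section FrameExistence

variable {M : Type*} [TopologicalSpace M] [ChartedSpace (EuclideanSpace ℝ (Fin 3)) M]

namespace Pseudohermitian

variable (S : Pseudohermitian M)

/-- A frame `{T, Z, conj Z}` with `T` the Reeb field and `Z` a section of `T_{1,0}` of Levi length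
`1` on `U`. The dual coframe, the connection and the torsion of a `LocalFrame` are constructed from
these data. -/
structure UnitaryFrame where
  U : Set M
  isOpen : IsOpen U
  T : Vec M
  Z : Vec M
  Z_mem : Z ∈ S.T10
  θ_T : ∀ q ∈ U, S.θ T q = 1
  dθ_Z_Zbar : ∀ q ∈ U, dForm S.θ Z (conjV Z) q = Complex.I
  dθ_T_Z : ∀ q ∈ U, dForm S.θ T Z q = 0
  dθ_T_Zbar : ∀ q ∈ U, dForm S.θ T (conjV Z) q = 0

namespace UnitaryFrame

variable {S} (F : S.UnitaryFrame)

/-- The form `θ^1` dual to `Z`. As `dθ = i θ^1 ∧ θ^{\bar 1}`, it is `W ↦ -i dθ(W, conj Z)`. -/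
def coframe : Form1 M := (-Complex.I) • (extDeriv S.θ).flip (conjV F.Z)

theorem coframe_apply (W : Vec M) (q : M) :
    F.coframe W q = -Complex.I * dForm S.θ W (conjV F.Z) q := rfl

theorem conjForm_coframe_apply (W : Vec M) (q : M) :
    conjForm F.coframe W q = Complex.I * dForm S.θ W F.Z q := by
  rw [conjForm_apply, conjF_apply, coframe_apply, S.dForm_θ_conjV, conjF_apply, map_mul,
    Complex.conj_conj, map_neg, Complex.conj_I, neg_neg]

variable {F} {q : M}

theorem isDualAt (hq : q ∈ F.U) : S.IsDualAt F.T F.Z F.coframe q where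
  θ_T := F.θ_T q hq
  θ_Z := by rw [S.θ_eq_zero F.Z_mem, CF.zero_apply]
  θ1_T := by rw [coframe_apply, F.dθ_T_Zbar q hq, mul_zero]
  θ1_Z := by rw [coframe_apply, F.dθ_Z_Zbar q hq, neg_mul, Complex.I_mul_I, neg_neg]
  θ1_Zbar := by rw [coframe_apply, dForm_self, CF.zero_apply, mul_zero]
  conjForm_θ1_T := by rw [conjForm_coframe_apply, F.dθ_T_Z q hq, mul_zero]

variable (F)

/-- The connection form `θ_1^1`. Its value on `conj Z` and on `T` is read off from `dθ^1`, its value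
on `Z` from skewness. -/
def conn : Form1 M :=
  conjF (F.coframe ⁅F.Z, conjV F.Z⁆) • F.coframe
    - F.coframe ⁅F.Z, conjV F.Z⁆ • conjForm F.coframe + F.coframe ⁅F.T, F.Z⁆ • S.θ

theorem conn_apply (W : Vec M) (q : M) :
    F.conn W q = (starRingEnd ℂ) (F.coframe ⁅F.Z, conjV F.Z⁆ q) * F.coframe W q
      - F.coframe ⁅F.Z, conjV F.Z⁆ q * conjForm F.coframe W q
      + F.coframe ⁅F.T, F.Z⁆ q * S.θ W q := by
  change (_ - _ + _ : CF M) q = _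
  rw [CF.add_apply, CF.sub_apply]
  rfl

variable [T2Space M] [IsManifold (𝓡 3) ∞ M] {F}

theorem dθ_T (hq : q ∈ F.U) (W : Vec M) : dForm S.θ F.T W q = 0 := by
  rw [(isDualAt hq).dForm_expand, F.dθ_T_Z q hq, F.dθ_T_Zbar q hq, wedge_apply F.coframe,
    (isDualAt hq).θ1_T, (isDualAt hq).conjForm_θ1_T]
  ring

theorem levi (hq : q ∈ F.U) (V W : Vec M) :
    dForm S.θ V W q = Complex.I * wedge F.coframe (conjForm F.coframe) V W q := by
  rw [(isDualAt hq).dForm_expand, F.dθ_T_Z q hq, F.dθ_T_Zbar q hq, F.dθ_Z_Zbar q hq]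
  ring

theorem conj_coframe_lie_T_Z (hq : q ∈ F.U) : (starRingEnd ℂ) (F.coframe ⁅F.T, F.Z⁆ q) =
    Complex.I * dForm S.θ ⁅F.T, conjV F.Z⁆ F.Z q := by
  have lie_conjV_T (f : CF M) : ⁅conjV F.T, conjV F.Z⁆ f q = ⁅F.T, conjV F.Z⁆ f q := by
    simp only [Derivation.commutator_apply, CF.sub_apply, (isDualAt hq).conjV_T,
      (conjV F.Z).congr_on F.isOpen (fun _ hq' => (isDualAt hq').conjV_T f) hq]
  rw [← conjForm_coframe_apply, ← form_congr_at _ lie_conjV_T, ← conjV_lie, conjForm_apply,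
    conjV_conjV, conjF_apply]

/-- This is `d²θ(T, Z, conj Z) = 0`. -/
theorem coframe_lie_T_Z_skew (hq : q ∈ F.U) :
    F.coframe ⁅F.T, F.Z⁆ q + (starRingEnd ℂ) (F.coframe ⁅F.T, F.Z⁆ q) = 0 := by
  have cyclic := congrArg (fun f : CF M => f q) (dForm_cyclic S.θ F.T F.Z (conjV F.Z))
  simp only [CF.sub_apply, CF.add_apply, CF.zero_apply] at cyclic
  rw [F.T.apply_eq_zero_of_const F.isOpen F.dθ_Z_Zbar hq,
    F.Z.apply_eq_zero_of_const F.isOpen F.dθ_T_Zbar hq,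
    (conjV F.Z).apply_eq_zero_of_const F.isOpen F.dθ_T_Z hq,
    dForm_swap S.θ F.T ⁅F.Z, conjV F.Z⁆, CF.neg_apply, dθ_T hq] at cyclic
  rw [conj_coframe_lie_T_Z hq, coframe_apply]
  linear_combination Complex.I * cyclic

theorem struct_eq (hq : q ∈ F.U) (V W : Vec M) : dForm F.coframe V W q =
    wedge F.coframe F.conn V W q
      + (-F.coframe ⁅F.T, conjV F.Z⁆) q * wedge S.θ (conjForm F.coframe) V W q := by
  have θ1_T (q') (hq' : q' ∈ F.U) := (isDualAt hq').θ1_T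
  have θ1_Z (q') (hq' : q' ∈ F.U) := (isDualAt hq').θ1_Z
  have θ1_Zbar (q') (hq' : q' ∈ F.U) := (isDualAt hq').θ1_Zbar
  rw [(isDualAt hq).dForm_expand, dForm_eq_neg_of_const F.isOpen θ1_T θ1_Z hq,
    dForm_eq_neg_of_const F.isOpen θ1_T θ1_Zbar hq, dForm_eq_neg_of_const F.isOpen θ1_Z θ1_Zbar hq]
  simp only [wedge_apply, conn_apply, CF.neg_apply]
  ring

theorem skew (hq : q ∈ F.U) (V : Vec M) : (F.conn V + conjForm F.conn V) q = 0 := by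
  rw [CF.add_apply, conjForm_apply, conjF_apply, conn_apply, conn_apply, S.θ_conjV,
    conjForm_apply F.coframe V, conjForm_apply F.coframe (conjV V), conjV_conjV]
  simp only [conjF_apply, map_add, map_sub, map_mul, Complex.conj_conj]
  linear_combination S.θ V q * coframe_lie_T_Z_skew hq

variable (F)

/-- The dual coframe, the connection and the torsion adjoined to a unitary frame. -/
def toLocalFrame : S.LocalFrame where
  U := F.U
  isOpen := F.isOpen
  T := F.T
  Z := F.Z
  θ1 := F.coframe
  conn := F.conn
  torsion := -F.coframe ⁅F.T, conjV F.Z⁆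
  Z_mem := F.Z_mem
  θ_T := F.θ_T
  dθ_T _ := dθ_T
  θ1_T _ hq := (isDualAt hq).θ1_T
  θ1_Z _ hq := (isDualAt hq).θ1_Z
  θ1_Zbar _ hq := (isDualAt hq).θ1_Zbar
  levi _ := levi
  struct_eq _ := struct_eq
  skew _ := skew

end UnitaryFrame

variable [T2Space M] [IsManifold (𝓡 3) ∞ M]

theorem exists_ker_ne_zero (p : M) : ∃ V : Vec M, S.θ V = 0 ∧ ∃ g, V g p ≠ 0 := by
  obtain ⟨b⟩ : Nonempty (SmoothBumpFunction (𝓡 3) p) := inferInstance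
  have hp := mem_coordDomain (b := b)
  obtain ⟨V, hV⟩ := S.θ_ne_zero p
  obtain ⟨j, hj⟩ : ∃ j, S.θ (coordVec b j) p ≠ 0 := by
    by_contra! vanish
    rw [form_apply_eq_sum_coord hp] at hV
    simp [vanish] at hV
  obtain ⟨i, hij⟩ := exists_ne j
  refine ⟨S.θ (coordVec b j) • coordVec b i - S.θ (coordVec b i) • coordVec b j, ?_,
    coord b i, ?_⟩
  · rw [map_sub, map_smul, map_smul, smul_eq_mul, smul_eq_mul]
    ring
  · simpa [coordVec_coord hp, hij] using hj

/-- If `V - i J V` and `conj V - i J (conj V)` both vanish at `p`, then so does `V`. -/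
theorem exists_T10_ne_zero (p : M) : ∃ Z ∈ S.T10, ∃ g, Z g p ≠ 0 := by
  obtain ⟨V, hV, g, hg⟩ := S.exists_ker_ne_zero p
  have hVbar : S.θ (conjV V) = 0 := by rw [S.θ_conjV, hV, map_zero]
  by_contra! vanish
  have vanish_V := vanish _ (S.sub_I_J_mem_T10 ⟨V, hV⟩) g
  have vanish_Vbar := vanish _ (S.sub_I_J_mem_T10 ⟨conjV V, hVbar⟩) (conjF g)
  simp only [Submodule.coe_sub, Submodule.coe_smul, Derivation.sub_apply, Derivation.smul_apply,
    smul_eq_mul, CF.sub_apply, CF.mul_apply, CF.algebraMap_apply,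
    S.J_real ⟨V, hV⟩ ⟨conjV V, hVbar⟩ rfl, conjV_apply, conjF_conjF, conjF_apply]
    at vanish_V vanish_Vbar
  have conj_vanish_Vbar := congrArg (starRingEnd ℂ) vanish_Vbar
  simp only [map_sub, map_mul, Complex.conj_conj, Complex.conj_I, map_zero] at conj_vanish_Vbar
  apply hg
  linear_combination (vanish_V + conj_vanish_Vbar) / 2

theorem exists_T10_normalized (p : M) : ∃ Z ∈ S.T10, ∀ᶠ q in 𝓝 p,
    dForm S.θ Z (conjV Z) q = Complex.I := by
  obtain ⟨Z, hZ, hg⟩ := S.exists_T10_ne_zero p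
  obtain ⟨hθ, hJ⟩ := S.mem_T10_iff.1 hZ
  obtain ⟨r, hr⟩ := exists_mul_conj_mul_eq_one (S.conjF_levi Z) (S.levi_pos ⟨Z, hθ⟩ hJ p hg)
  refine ⟨r • Z, S.T10.smul_mem r hZ, ?_⟩
  filter_upwards [hr] with q hq
  rw [conjV_smul, ← extDeriv_apply, map_smul, map_smul, LinearMap.smul_apply, extDeriv_apply]
  simp only [smul_eq_mul, CF.mul_apply, CF.smul_apply] at hq ⊢
  linear_combination Complex.I * hq +
    (r q * conjF r q * dForm S.θ Z (conjV Z) q) * Complex.I_mul_I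

theorem exists_θ_eq_one (p : M) : ∃ V : Vec M, ∀ᶠ q in 𝓝 p, S.θ V q = 1 := by
  obtain ⟨V, hV⟩ := S.θ_ne_zero p
  obtain ⟨r, hr⟩ := exists_eventually_eq_comp (f := S.θ V) isOpen_ne
    (fun z hz => (contDiffAt_inv ℝ hz).contDiffWithinAt) hV
  refine ⟨r • V, ?_⟩
  filter_upwards [hr, (S.θ V).contMDiff.continuous.continuousAt.eventually_ne hV] with q hrq hq
  rw [map_smul, smul_eq_mul, CF.mul_apply, hrq]
  exact inv_mul_cancel₀ hq

theorem exists_unitaryFrame (p : M) : ∃ F : S.UnitaryFrame, p ∈ F.U := by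
  obtain ⟨Z, hZ, normalized⟩ := S.exists_T10_normalized p
  obtain ⟨V, θ_V⟩ := S.exists_θ_eq_one p
  obtain ⟨U, hU, hUo, hpU⟩ := mem_nhds_iff.1 (normalized.and θ_V)
  have Z_Zbar (q) (hq : q ∈ U) : dForm S.θ Z (conjV Z) q = Complex.I := (hU hq).1
  let T : Vec M := V + (Complex.I • dForm S.θ V (conjV Z)) • Z +
    (-(Complex.I • dForm S.θ V Z)) • conjV Z
  have dθ_T (W q) : dForm S.θ T W q = dForm S.θ V W q +
      Complex.I * dForm S.θ V (conjV Z) q * dForm S.θ Z W q +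
      -(Complex.I * dForm S.θ V Z q) * dForm S.θ (conjV Z) W q := by
    simp only [T, dForm_add_left, dForm_smul_left, CF.add_apply, CF.mul_apply, CF.smul_apply,
      CF.neg_apply]
  refine ⟨⟨U, hUo, T, Z, hZ, fun q hq => ?_, Z_Zbar, fun q hq => ?_, fun q hq => ?_⟩, hpU⟩
  · simp only [T, map_add, map_smul, S.θ_eq_zero hZ, S.θ_conjV_eq_zero hZ, smul_zero, add_zero]
    exact (hU hq).2
  · rw [dθ_T, dForm_self, dForm_swap S.θ Z (conjV Z), CF.neg_apply, Z_Zbar q hq, CF.zero_apply]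
    linear_combination dForm S.θ V Z q * Complex.I_mul_I
  · rw [dθ_T, dForm_self, Z_Zbar q hq, CF.zero_apply]
    linear_combination dForm S.θ V (conjV Z) q * Complex.I_mul_I

theorem exists_localFrame (p : M) : ∃ F : S.LocalFrame, p ∈ F.U := by
  obtain ⟨F, hp⟩ := S.exists_unitaryFrame p
  exact ⟨F.toLocalFrame, hp⟩

end Pseudohermitian

end FrameExistence

section ConjugateForms

variable {M : Type*} [TopologicalSpace M] [ChartedSpace (EuclideanSpace ℝ (Fin 3)) M]

namespace Pseudohermitian

variable {S : Pseudohermitian M} {p : M}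

theorem LocalFrame.θ1_Zbar_eq_zero [T2Space M] [IsManifold (𝓡 3) ∞ M] {F : S.LocalFrame}
    (hp : p ∈ F.U) {V : Vec M} (hV : V ∈ S.T10) : F.θ1 (conjV V) p = 0 := by
  simpa only [conjForm_apply, conjF_apply, map_eq_zero] using
    LocalFrame.conjForm_θ1_eq_zero hp hV

namespace LocalFrame

variable (F : S.LocalFrame)

/-- The coefficient `f_{\bar 1 1 1} + i A_{11} f_{\bar 1}` of `P_3 f`. -/
def P3coeff (f : CF M) : CF M := F.cbar11 (F.Zbar f) + Complex.I • (F.A11 * F.Zbar f)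

/-- The form `i (f_{\bar 1} θ^{\bar 1} - f_1 θ^1) + l θ`, with `l` such that its exterior derivative
has no `θ^1 ∧ θ^{\bar 1}` component. -/
def conjugateForm (f : CF M) : Form1 M :=
  (Complex.I • F.Zbar f) • conjForm F.θ1 - (Complex.I • F.Z f) • F.θ1
    - ((2 : ℂ) • (F.Z (F.Zbar f) + F.conn F.Z * F.Zbar f) + Complex.I • F.T f) • S.θ

theorem conjugateForm_apply (f : CF M) (V : Vec M) (p : M) :
    F.conjugateForm f V p = Complex.I * F.Zbar f p * conjForm F.θ1 V p
      - Complex.I * F.Z f p * F.θ1 V p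
      - (2 * (F.Z (F.Zbar f) p + F.conn F.Z p * F.Zbar f p) + Complex.I * F.T f p) * S.θ V p := by
  change (_ - _ - _ : CF M) p = _
  rw [CF.sub_apply, CF.sub_apply]
  rfl

variable {F}

theorem conjugateForm_Z (hp : p ∈ F.U) (f : CF M) :
    F.conjugateForm f F.Z p = ((-Complex.I) • F.Z f) p := by
  rw [conjugateForm_apply, (isDualAt hp).conjForm_θ1_Z, F.θ1_Z p hp, F.θ_Z, CF.zero_apply,
    CF.smul_apply]
  ring

theorem conjugateForm_Zbar (hp : p ∈ F.U) (f : CF M) :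
    F.conjugateForm f F.Zbar p = (Complex.I • F.Zbar f) p := by
  rw [conjugateForm_apply, ← conjV_Z, (isDualAt hp).conjForm_θ1_Zbar, F.θ1_Zbar p hp,
    (isDualAt hp).θ_Zbar, CF.smul_apply]
  ring

theorem conjugateForm_T (hp : p ∈ F.U) (f : CF M) : F.conjugateForm f F.T p =
    ((-2 : ℂ) • (F.Z (F.Zbar f) + F.conn F.Z * F.Zbar f) + (-Complex.I) • F.T f) p := by
  rw [conjugateForm_apply, (isDualAt hp).conjForm_θ1_T, F.θ1_T p hp, F.θ_T p hp]
  simp only [CF.add_apply, CF.smul_apply, CF.mul_apply]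
  ring

variable [T2Space M] [IsManifold (𝓡 3) ∞ M]

theorem cbar11_apply (hp : p ∈ F.U) (s : CF M) :
    F.cbar11 s p = F.Z (F.Z s + F.conn F.Z * s) p := by
  have cov_apply (q) (hq : q ∈ F.U) : F.cov 0 1 F.Z s q = (F.Z s + F.conn F.Z * s) q := by
    have skew := F.skew q hq F.Z
    rw [CF.add_apply] at skew
    simp only [cov, zero_smul, one_smul, zero_add, CF.sub_apply, CF.add_apply, CF.mul_apply]
    linear_combination -s q * skew
  rw [cbar11, cov, CF.sub_apply, CF.mul_apply, one_smul, one_smul, F.skew p hp, zero_mul, sub_zero]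
  exact F.Z.congr_on F.isOpen cov_apply hp

theorem P3coeff_apply (hp : p ∈ F.U) (f : CF M) :
    F.P3coeff f p = F.Z (F.Z (F.Zbar f) + F.conn F.Z * F.Zbar f) p +
      Complex.I * (F.A11 p * F.Zbar f p) := by
  rw [P3coeff, CF.add_apply, cbar11_apply hp, CF.smul_apply, CF.mul_apply]

theorem dForm_conjugateForm_Z_Zbar (hp : p ∈ F.U) (f : CF M) :
    dForm (F.conjugateForm f) F.Z F.Zbar p = 0 := by
  have commutator := form_lie_Z_Zbar hp (differential f)
  simp only [differential_apply, Derivation.commutator_apply, CF.sub_apply] at commutator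
  rw [dForm, CF.sub_apply, CF.sub_apply, form_lie_Z_Zbar hp,
    F.Z.congr_on F.isOpen (fun q hq => conjugateForm_Zbar hq f) hp,
    F.Zbar.congr_on F.isOpen (fun q hq => conjugateForm_Z hq f) hp, conjugateForm_T hp,
    conjugateForm_Z hp, conjugateForm_Zbar hp]
  simp only [Derivation.map_smul, CF.add_apply, CF.smul_apply, CF.mul_apply]
  linear_combination -Complex.I * commutator

theorem dForm_conjugateForm_T_Z (hp : p ∈ F.U) (f : CF M) :
    dForm (F.conjugateForm f) F.T F.Z p = 2 * F.P3coeff f p := by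
  have commutator := form_lie_T_Z hp (differential f)
  simp only [differential_apply, Derivation.commutator_apply, CF.sub_apply] at commutator
  rw [dForm, CF.sub_apply, CF.sub_apply, form_lie_T_Z hp, P3coeff_apply hp,
    F.T.congr_on F.isOpen (fun q hq => conjugateForm_Z hq f) hp,
    F.Z.congr_on F.isOpen (fun q hq => conjugateForm_T hq f) hp, conjugateForm_Z hp,
    conjugateForm_Zbar hp]
  simp only [map_add, Derivation.map_smul, CF.add_apply, CF.smul_apply]
  linear_combination -Complex.I * commutator

end LocalFrame

variable (S) in
/-- `α` is a Rumin lift of `d^c f = i (\bar∂_b f - ∂_b f)` over `O`: it restricts to `d^c f` on the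
contact bundle and `dα` vanishes there. If `f` is real, the real primitives `g` of `α` are the real
functions for which `f + i g` is CR holomorphic. -/
def IsConjugateFormOn (f : CF M) (α : Form1 M) (O : Set M) : Prop :=
  ∀ V ∈ S.T10, ∀ q ∈ O, α V q = -Complex.I * V f q ∧
    α (conjV V) q = Complex.I * conjV V f q ∧ dForm α V (conjV V) q = 0

variable [T2Space M] [IsManifold (𝓡 3) ∞ M] {f : CF M}

theorem LocalFrame.isConjugateFormOn (F : S.LocalFrame) (f : CF M) :
    S.IsConjugateFormOn f (F.conjugateForm f) F.U := by
  intro V hV q hq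
  have θ_V : S.θ V q = 0 := by rw [S.θ_eq_zero hV, CF.zero_apply]
  have θ_Vbar : S.θ (conjV V) q = 0 := by rw [S.θ_conjV_eq_zero hV, CF.zero_apply]
  have conjθ1_V := conjForm_θ1_eq_zero hq hV
  have θ1_Vbar := θ1_Zbar_eq_zero hq hV
  refine ⟨?_, ?_, ?_⟩
  · rw [conjugateForm_apply, θ_V, conjθ1_V, vec_eq_mul_Z hq hV]
    ring
  · rw [conjugateForm_apply, θ_Vbar, θ1_Vbar, (isDualAt hq).vec_expand (conjV V), θ_Vbar, θ1_Vbar,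
      conjV_Z]
    ring
  · rw [(isDualAt hq).dForm_expand, conjV_Z, dForm_conjugateForm_Z_Zbar hq, wedge_apply,
      wedge_apply, θ_V, θ_Vbar]
    ring

namespace IsConjugateFormOn

variable {α β : Form1 M} {O : Set M}

/-- The difference `γ` of two lifts is a multiple of `θ`, and `dγ(Z, conj Z) = i γ(T)`. -/
theorem apply_eq (hα : S.IsConjugateFormOn f α O) (hβ : S.IsConjugateFormOn f β O) (hO : IsOpen O)
    (hp : p ∈ O) (V : Vec M) : α V p = β V p := by
  obtain ⟨F, hpF⟩ := S.exists_localFrame p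
  have γ_Z (q) (hq : q ∈ O) : (α - β) F.Z q = 0 := by
    rw [LinearMap.sub_apply, CF.sub_apply, (hα F.Z F.Z_mem q hq).1, (hβ F.Z F.Z_mem q hq).1,
      sub_self]
  have γ_Zbar (q) (hq : q ∈ O) : (α - β) F.Zbar q = 0 := by
    rw [LinearMap.sub_apply, CF.sub_apply, ← LocalFrame.conjV_Z, (hα F.Z F.Z_mem q hq).2.1,
      (hβ F.Z F.Z_mem q hq).2.1, sub_self]
  have dγ : dForm (α - β) F.Z F.Zbar p = 0 := by
    rw [dForm_sub, CF.sub_apply, ← LocalFrame.conjV_Z, (hα F.Z F.Z_mem p hp).2.2,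
      (hβ F.Z F.Z_mem p hp).2.2, sub_self]
  have γ_T : (α - β) F.T p = 0 := by
    rw [dForm_eq_neg_of_const hO γ_Z γ_Zbar hp, LocalFrame.form_lie_Z_Zbar hpF, γ_Z p hp,
      γ_Zbar p hp] at dγ
    simpa using dγ
  have γ_V := LocalFrame.form_expand hpF (α - β) V
  rw [γ_T, γ_Z p hp, γ_Zbar p hp, LinearMap.sub_apply, CF.sub_apply] at γ_V
  linear_combination γ_V

theorem dForm_T_Z (hα : S.IsConjugateFormOn f α O) (hO : IsOpen O) (hp : p ∈ O)
    {F : S.LocalFrame} (hpF : p ∈ F.U) : dForm α F.T F.Z p = 2 * F.P3coeff f p := by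
  rw [← LocalFrame.dForm_conjugateForm_T_Z hpF]
  refine dForm_congr_form (hO.inter F.isOpen) (fun q hq V => ?_) ⟨hp, hpF⟩ _ _
  exact apply_eq (fun V hV q hq => hα V hV q hq.1)
    (fun V hV q hq => F.isConjugateFormOn f V hV q hq.2) (hO.inter F.isOpen) hq V

end IsConjugateFormOn

namespace LocalFrame

variable {F F' : S.LocalFrame}

theorem θ1_eq_mul_θ1 (hp : p ∈ F.U) (hp' : p ∈ F'.U) (V : Vec M) :
    F.θ1 V p = F.θ1 F'.Z p * F'.θ1 V p := by
  have Reeb : F.θ1 F'.T p = 0 := by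
    have dθ := F.levi p hp F'.T F.Zbar
    rw [F'.dθ_T p hp', wedge_apply, ← conjV_Z, F.θ1_Zbar p hp,
      (isDualAt hp).conjForm_θ1_Zbar] at dθ
    simpa using dθ
  rw [form_expand hp' F.θ1 V, Reeb, ← conjV_Z, θ1_Zbar_eq_zero hp F'.Z_mem]
  ring

theorem Zbar_mul_conjForm_θ1_eq (hp : p ∈ F.U) (hp' : p ∈ F'.U) (f : CF M) (V : Vec M) :
    F'.Zbar f p * conjForm F'.θ1 V p = F.Zbar f p * conjForm F.θ1 V p := by
  rw [← conjV_Z, ← conjV_Z, conjV_apply, conjV_apply, conjForm_apply, conjForm_apply, conjF_apply,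
    conjF_apply, conjF_apply, conjF_apply, vec_eq_mul_Z hp F'.Z_mem, θ1_eq_mul_θ1 hp hp' (conjV V),
    ← map_mul, ← map_mul]
  ring_nf

/-- Both coefficients are read off from the same form `dα`, where `α` is a lift of `d^c f`. -/
theorem P3coeff_mul_θ1_eq (hp : p ∈ F.U) (hp' : p ∈ F'.U) (f : CF M) (V : Vec M) :
    F'.P3coeff f p * F'.θ1 V p = F.P3coeff f p * F.θ1 V p := by
  have lift := F.isConjugateFormOn f
  have coeff_eq : 2 * F'.P3coeff f p = F.θ1 F'.Z p * (2 * F.P3coeff f p) := by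
    rw [← lift.dForm_T_Z F.isOpen hp hp', ← lift.dForm_T_Z F.isOpen hp hp,
      (isDualAt hp).dForm_expand, wedge_apply, wedge_apply, wedge_apply, F'.θ_T p hp',
      F'.θ_Z, θ1_eq_mul_θ1 hp hp' F'.T, F'.θ1_T p hp', conjForm_θ1_eq_zero hp F'.Z_mem,
      CF.zero_apply, (lift F.Z F.Z_mem p hp).2.2]
    ring
  rw [θ1_eq_mul_θ1 hp hp' V]
  linear_combination F'.θ1 V p / 2 * coeff_eq

end LocalFrame

end Pseudohermitian

end ConjugateForms

section Pluriharmonic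

variable {M : Type*} [TopologicalSpace M] [ChartedSpace (EuclideanSpace ℝ (Fin 3)) M]

namespace Pseudohermitian

variable {S : Pseudohermitian M} {f : CF M} {p : M}

theorem pluriharmonic_le_realFunctions : S.pluriharmonic ≤ realFunctions M := fun f hf p => by
  obtain ⟨U, -, hpU, H, -, hfH⟩ := hf p
  rw [hfH p hpU, Complex.ofReal_im]

theorem conjF_eq_self (real : f ∈ realFunctions M) : conjF f = f := by
  ext q
  exact Complex.conj_eq_iff_im.2 (real q)

theorem IsConjugateFormOn.conjForm {α : Form1 M} {O : Set M}
    (hα : S.IsConjugateFormOn f α O) (real : f ∈ realFunctions M) :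
    S.IsConjugateFormOn f (CR.conjForm α) O := by
  intro V hV q hq
  obtain ⟨α_V, α_Vbar, dα⟩ := hα V hV q hq
  refine ⟨?_, ?_, ?_⟩
  · rw [conjForm_apply, conjF_apply, α_Vbar, conjV_apply, conjF_eq_self real]
    simp
  · rw [conjForm_apply, conjF_apply, conjV_conjV, α_V, conjV_apply, conjF_eq_self real]
    simp
  · have := congrArg conjF (dForm_conjV α V (conjV V))
    rw [conjF_conjF] at this
    rw [← this, conjV_conjV, dForm_swap, map_neg, CF.neg_apply, conjF_apply, dα]
    simp

variable [T2Space M] [IsManifold (𝓡 3) ∞ M]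

theorem IsCROn.isConjugateFormOn_differential {H : CF M} {O : Set M} (hO : IsOpen O)
    (hH : S.IsCROn H O) (re : ∀ q ∈ O, f q = ((H q).re : ℂ)) :
    S.IsConjugateFormOn f (differential ((-Complex.I / 2) • (H - conjF H))) O := by
  have f_eq (V : Vec M) (q) (hq : q ∈ O) : V f q = (V H q + V (conjF H) q) / 2 := by
    rw [V.congr_on hO (g := (1 / 2 : ℂ) • (H + conjF H)) (fun q hq => ?_) hq,
      Derivation.map_smul, map_add, CF.smul_apply, CF.add_apply]
    · ring
    · rw [re q hq, CF.smul_apply, CF.add_apply, conjF_apply, Complex.add_conj]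
      push_cast
      ring
  intro V hV q hq
  have Vbar_H := hH V hV q hq
  have V_conj_H : V (conjF H) q = 0 := by
    rwa [conjV_apply, conjF_apply, map_eq_zero] at Vbar_H
  refine ⟨?_, ?_, by rw [dForm_differential, CF.zero_apply]⟩ <;>
  · rw [differential_apply, f_eq _ q hq, Derivation.map_smul, map_sub, CF.smul_apply, CF.sub_apply]
    simp only [Vbar_H, V_conj_H]
    ring

theorem P3coeff_eq_zero_of_mem_pluriharmonic (hf : f ∈ S.pluriharmonic) {F : S.LocalFrame}
    (hp : p ∈ F.U) : F.P3coeff f p = 0 := by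
  obtain ⟨U, hU, hpU, H, hH, re⟩ := hf p
  have closed := (hH.isConjugateFormOn_differential hU re).dForm_T_Z hU hpU hp
  rw [dForm_differential, CF.zero_apply] at closed
  simpa using closed.symm

namespace IsConjugateFormOn

variable {α : Form1 M} {O : Set M}

theorem conjForm_apply_eq (hα : S.IsConjugateFormOn f α O) (real : f ∈ realFunctions M)
    (hO : IsOpen O) (hp : p ∈ O) (V : Vec M) : CR.conjForm α V p = α V p :=
  (hα.conjForm real).apply_eq hα hO hp V

theorem dForm_eq_zero (hα : S.IsConjugateFormOn f α O) (real : f ∈ realFunctions M)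
    (hO : IsOpen O) (hp : p ∈ O) {F : S.LocalFrame} (hpF : p ∈ F.U) (coeff : F.P3coeff f p = 0)
    (V W : Vec M) : dForm α V W p = 0 := by
  have dα_T_Z : dForm α F.T F.Z p = 0 := by rw [hα.dForm_T_Z hO hp hpF, coeff, mul_zero]
  have dα_T_Zbar : dForm α F.T (conjV F.Z) p = 0 := by
    rw [← dForm_congr_at α (LocalFrame.isDualAt hpF).conjV_T fun _ => rfl, dForm_conjV, conjF_apply,
      dForm_congr_form hO (fun q hq => hα.conjForm_apply_eq real hO hq) hp, dα_T_Z, map_zero]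
  rw [(LocalFrame.isDualAt hpF).dForm_expand, dα_T_Z, dα_T_Zbar, (hα F.Z F.Z_mem p hp).2.2]
  ring

theorem isCROn (hα : S.IsConjugateFormOn f α O) (real : f ∈ realFunctions M) (hO : IsOpen O)
    {G : CF M} (primitive : ∀ q ∈ O, ∀ V : Vec M, V G q = α V q) :
    S.IsCROn (f + (Complex.I / 2) • (G + conjF G)) O := by
  intro V hV q hq
  have conj_primitive : conjV V (conjF G) q = α (conjV V) q := by
    rw [conjV_apply, conjF_conjF, conjF_apply, primitive q hq,
      ← hα.conjForm_apply_eq real hO hq (conjV V), conjForm_apply, conjF_apply, conjV_conjV]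
  rw [map_add, Derivation.map_smul, map_add, CF.add_apply, CF.smul_apply, CF.add_apply,
    conj_primitive, primitive q hq, (hα V hV q hq).2.1]
  linear_combination conjV V f q * Complex.I_mul_I

end IsConjugateFormOn

theorem mem_pluriharmonic_of_P3coeff_eq_zero (real : f ∈ realFunctions M)
    (coeff : ∀ F : S.LocalFrame, ∀ p ∈ F.U, F.P3coeff f p = 0) : f ∈ S.pluriharmonic := fun p => by
  obtain ⟨F, hp⟩ := S.exists_localFrame p
  have hU : ∀ᶠ q in 𝓝 p, q ∈ F.U := F.isOpen.mem_nhds hp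
  have lift := F.isConjugateFormOn f
  obtain ⟨G, hG⟩ := exists_primitive_of_dForm_eq_zero (α := F.conjugateForm f) (p := p) (by
    filter_upwards [hU] with q hq
    exact lift.dForm_eq_zero real F.isOpen hq hq (coeff F q hq))
  obtain ⟨O, hO, hOo, hpO⟩ := mem_nhds_iff.1 (hU.and hG)
  have lift_O : S.IsConjugateFormOn f (F.conjugateForm f) O :=
    fun V hV q hq => lift V hV q (hO hq).1
  refine ⟨O, hOo, hpO, _, lift_O.isCROn real hOo fun q hq => (hO hq).2, fun q _ => ?_⟩
  rw [CF.add_apply, CF.smul_apply, CF.add_apply, conjF_apply, Complex.add_conj]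
  apply Complex.ext
  · simp
  · simpa using real q

theorem mem_pluriharmonic_iff : f ∈ S.pluriharmonic ↔
    f ∈ realFunctions M ∧ ∀ F : S.LocalFrame, ∀ p ∈ F.U, F.P3coeff f p = 0 :=
  ⟨fun hf => ⟨pluriharmonic_le_realFunctions hf,
      fun _ _ => P3coeff_eq_zero_of_mem_pluriharmonic hf⟩,
    fun hf => mem_pluriharmonic_of_P3coeff_eq_zero hf.1 hf.2⟩

end Pseudohermitian

end Pluriharmonic

section Relations

variable {k X Y Z : Type*}

section DivisionSemiring

variable [DivisionSemiring k] [AddCommMonoid X] [Module k X] [AddCommMonoid Y] [Module k Y]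
  [AddCommMonoid Z] [Module k Z] {R R' : Submodule k (X × Y)} {c : k}

theorem existsUnique_mem_of_iff_smul_mem (hc : c ≠ 0) {x : X}
    (h : ∀ y, (x, y) ∈ R ↔ (x, c • y) ∈ R') (hR' : ∃! y, (x, y) ∈ R') : ∃! y, (x, y) ∈ R := by
  obtain ⟨y, hy, unique⟩ := hR'
  refine ⟨c⁻¹ • y, (h _).2 (by rwa [smul_inv_smul₀ hc]), fun z hz => ?_⟩
  rw [← unique _ ((h z).1 hz), inv_smul_smul₀ hc]

theorem relKer_eq_of_iff_smul_mem (h : ∀ x y, (x, y) ∈ R ↔ (x, c • y) ∈ R') :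
    relKer R = relKer R' := by
  ext x
  change (x, 0) ∈ R ↔ (x, 0) ∈ R'
  rw [h, smul_zero]

theorem relIm_eq_of_iff_smul_mem (hc : c ≠ 0) (h : ∀ x y, (x, y) ∈ R ↔ (x, c • y) ∈ R') :
    relIm R = relIm R' := by
  ext y
  constructor
  · rintro ⟨⟨x, y⟩, hxy, rfl⟩
    have smul_mem : c⁻¹ • (x, c • y) ∈ R' := R'.smul_mem c⁻¹ ((h x y).1 hxy)
    rw [Prod.smul_mk, inv_smul_smul₀ hc] at smul_mem
    exact ⟨(c⁻¹ • x, y), smul_mem, rfl⟩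
  · rintro ⟨⟨x, y⟩, hxy, rfl⟩
    exact ⟨(c • x, y), (h _ _).2 (R'.smul_mem c hxy), rfl⟩

theorem relComp_iff_smul_mem (hc : c ≠ 0) (h : ∀ x y, (x, y) ∈ R ↔ (x, c • y) ∈ R')
    {Q : Submodule k (Y × Z)} (x : X) (z : Z) :
    (x, z) ∈ relComp R Q ↔ (x, c • z) ∈ relComp R' Q := by
  constructor
  · rintro ⟨y, hxy, hyz⟩
    exact ⟨c • y, (h x y).1 hxy, Q.smul_mem c hyz⟩
  · rintro ⟨y, hxy, hyz⟩
    refine ⟨c⁻¹ • y, (h _ _).2 (by rwa [smul_inv_smul₀ hc]), ?_⟩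
    simpa only [Prod.smul_mk, inv_smul_smul₀ hc] using Q.smul_mem c⁻¹ hyz

end DivisionSemiring

theorem isIsoOnto_of_existsUnique [Semiring k] [AddCommMonoid X] [Module k X] [AddCommMonoid Y]
    [Module k Y] {R : Submodule k (X × Y)} {W : Submodule k X} {K : Submodule k Y}
    (value : ∀ x ∈ W, ∃! y, y ∈ K ∧ (x, y) ∈ R) (preimage : ∀ y ∈ K, ∃! x, x ∈ W ∧ (x, y) ∈ R) :
    IsIsoOnto R W K := by
  choose! φ hφ unique using value
  let Φ : W →ₗ[k] K :=
    { toFun := fun w => ⟨φ w, (hφ w w.2).1⟩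
      map_add' := fun v w => Subtype.ext (unique _ (v + w).2 _
        ⟨K.add_mem (hφ v v.2).1 (hφ w w.2).1, R.add_mem (hφ v v.2).2 (hφ w w.2).2⟩).symm
      map_smul' := fun c w => Subtype.ext (unique _ (c • w).2 _
        ⟨K.smul_mem c (hφ w w.2).1, R.smul_mem c (hφ w w.2).2⟩).symm }
  have injective : Function.Injective Φ := fun v w hvw => by
    have φ_eq : φ v = φ w := congrArg Subtype.val hvw
    exact Subtype.ext ((preimage _ (hφ w w.2).1).unique ⟨v.2, φ_eq ▸ (hφ v v.2).2⟩
      ⟨w.2, (hφ w w.2).2⟩)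
  have surjective : Function.Surjective Φ := fun y => by
    obtain ⟨x, ⟨hx, hxy⟩, -⟩ := preimage y y.2
    exact ⟨⟨x, hx⟩, Subtype.ext (unique x hx y ⟨y.2, hxy⟩).symm⟩
  exact ⟨LinearEquiv.ofBijective Φ ⟨injective, surjective⟩, fun w => (hφ w w.2).2⟩

theorem IsSupplementary.isIsoOnto [Ring k] [AddCommGroup X] [Module k X] [AddCommMonoid Y]
    [Module k Y] [AddCommMonoid Z] [Module k Z] {R : Submodule k (X × Y)} {Q : Submodule k (Y × Z)}
    {W : Submodule k X} (hW : IsSupplementary (relKer (relComp R Q)) (relKer R) W)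
    (unique : ∀ x y z, (x, y) ∈ R → (x, z) ∈ R → y = z) :
    IsIsoOnto R W (relKer Q ⊓ relIm R) := by
  let : AddCommGroup Y := Module.addCommMonoidToAddCommGroup k
  obtain ⟨disjoint, sup_eq⟩ := hW
  refine isIsoOnto_of_existsUnique (fun w hw => ?_) ?_
  · have w_mem : w ∈ relKer (relComp R Q) := sup_eq ▸ Submodule.mem_sup_right hw
    obtain ⟨y, hwy, hy⟩ := w_mem
    exact ⟨y, ⟨⟨hy, (w, y), hwy, rfl⟩, hwy⟩, fun z hz => unique w z y hz.2 hwy⟩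
  · rintro _ ⟨hy, ⟨x, y⟩, hxy, rfl⟩
    have x_mem : x ∈ relKer R ⊔ W := sup_eq ▸ ⟨y, hxy, hy⟩
    obtain ⟨u, hu, w, hw, rfl⟩ := Submodule.mem_sup.1 x_mem
    have hwy : (u + w, y) - (u, 0) ∈ R := R.sub_mem hxy hu
    rw [Prod.mk_sub_mk, add_sub_cancel_left, sub_zero] at hwy
    refine ⟨w, ⟨hw, hwy⟩, fun v ⟨hv, hvy⟩ => ?_⟩
    have hvw : (v, y) - (w, y) ∈ R := R.sub_mem hvy hwy
    rw [Prod.mk_sub_mk, sub_self] at hvw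
    have diff_mem : v - w ∈ relKer R ⊓ W := ⟨hvw, W.sub_mem hv hw⟩
    rwa [disjoint, Submodule.mem_bot, sub_eq_zero] at diff_mem

end Relations

section RealRestriction

variable {M : Type*} [TopologicalSpace M] [ChartedSpace (EuclideanSpace ℝ (Fin 3)) M]
  {Y Z : Type*} [AddCommMonoid Y] [Module ℝ Y] [Module ℂ Y] [IsScalarTower ℝ ℂ Y]
  [AddCommMonoid Z] [Module ℝ Z] [Module ℂ Z] [IsScalarTower ℝ ℂ Z]

theorem relKer_onReal (R : Submodule ℂ (CF M × Y)) :
    relKer (onReal R) = (relKer R).restrictScalars ℝ ⊓ realFunctions M :=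
  Submodule.ext fun _ => ⟨fun h => ⟨h.1, h.2.1⟩, fun h => ⟨h.1, h.2, trivial⟩⟩

theorem relComp_onReal (R : Submodule ℂ (CF M × Y)) (Q : Submodule ℂ (Y × Z)) :
    relComp (onReal R) (Q.restrictScalars ℝ) = onReal (relComp R Q) :=
  Submodule.ext fun _ => ⟨fun ⟨y, h, hy⟩ => ⟨⟨y, h.1, hy⟩, h.2.1, trivial⟩,
    fun ⟨⟨y, h, hy⟩, real⟩ => ⟨y, ⟨h, real.1, trivial⟩, hy⟩⟩

theorem IsSupplementary.isIsoOnto_onReal {R : Submodule ℂ (CF M × Y)} {Q : Submodule ℂ (Y × Z)}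
    {W : Submodule ℝ (CF M)}
    (hW : IsSupplementary (relKer (onReal (relComp R Q))) (relKer (onReal R)) W)
    (unique : ∀ f y z, (f, y) ∈ R → (f, z) ∈ R → y = z) :
    IsIsoOnto (onReal R) W ((relKer Q).restrictScalars ℝ ⊓ relIm (onReal R)) := by
  rw [← relComp_onReal] at hW
  exact hW.isIsoOnto fun f y z hy hz => unique f y z hy.1 hz.1

end RealRestriction

section Operators

variable {M : Type*} [TopologicalSpace M] [ChartedSpace (EuclideanSpace ℝ (Fin 3)) M]

namespace Pseudohermitian

variable {S : Pseudohermitian M} {p : M} {f g : CF M} {σ : Form1 M} {η η' : Form2 M}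

theorem LocalFrame.wedge_θ_Z_T {F : S.LocalFrame} (hp : p ∈ F.U) (σ : Form1 M) :
    wedge σ S.θ F.Z F.T p = σ F.Z p := by
  rw [wedge_apply, F.θ_T p hp, F.θ_Z, CF.zero_apply]
  ring

theorem wedgeθ_mem_F20 (hσ : σ ∈ S.E10) : S.wedgeθ σ ∈ S.F20 := by
  intro F p hp V W
  change wedge σ S.θ V W p = wedge σ S.θ F.Z F.T p * wedge F.θ1 S.θ V W p
  rw [LocalFrame.wedge_θ_Z_T hp, wedge_apply, wedge_apply, hσ F p hp V, hσ F p hp W]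
  ring

variable [T2Space M] [IsManifold (𝓡 3) ∞ M]

theorem LocalFrame.c1bar_congr {F : S.LocalFrame} {s s' : CF M} (h : ∀ q ∈ F.U, s q = s' q)
    (hp : p ∈ F.U) : F.c1bar s p = F.c1bar s' p := by
  simp only [c1bar, cov, CF.sub_apply, CF.mul_apply, F.Zbar.congr_on F.isOpen h hp, h p hp]

theorem LocalFrame.cbar11_congr {F : S.LocalFrame} {s s' : CF M} (h : ∀ q ∈ F.U, s q = s' q)
    (hp : p ∈ F.U) : F.cbar11 s p = F.cbar11 s' p := by
  rw [cbar11_apply hp, cbar11_apply hp]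
  refine F.Z.congr_on F.isOpen (fun q hq => ?_) hp
  rw [CF.add_apply, CF.add_apply, CF.mul_apply, CF.mul_apply, h q hq, F.Z.congr_on F.isOpen h hq]

theorem exists_glued_form (α : S.LocalFrame → Form1 M)
    (compatible : ∀ F F' : S.LocalFrame, ∀ p ∈ F.U ∩ F'.U, ∀ V, α F' V p = α F V p) :
    ∃ σ : Form1 M, ∀ F : S.LocalFrame, ∀ p ∈ F.U, ∀ V, σ V p = α F V p := by
  choose Φ hΦ using S.exists_localFrame
  refine ⟨{ toFun := fun V => ⟨fun q => α (Φ q) V q, fun p => ?_⟩, map_add' := fun V W => ?_,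
            map_smul' := fun b V => ?_ }, fun F p hp V => compatible F (Φ p) p ⟨hp, hΦ p⟩ V⟩
  · refine (α (Φ p) V).contMDiff.contMDiffAt.congr_of_eventuallyEq ?_
    filter_upwards [(Φ p).isOpen.mem_nhds (hΦ p)] with q hq
    exact compatible (Φ p) (Φ q) q ⟨hq, hΦ q⟩ V
  · ext q
    change α (Φ q) (V + W) q = α (Φ q) V q + α (Φ q) W q
    rw [map_add, CF.add_apply]
  · ext q
    change α (Φ q) (b • V) q = b q * α (Φ q) V q
    rw [map_smul, smul_eq_mul, CF.mul_apply]

variable (S) in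
theorem exists_mem_P3 (f : CF M) : ∃ σ, (f, σ) ∈ S.P3 := by
  obtain ⟨σ, hσ⟩ := exists_glued_form (fun F : S.LocalFrame => F.P3coeff f • F.θ1)
    fun F F' p hp V => LocalFrame.P3coeff_mul_θ1_eq hp.1 hp.2 f V
  have σ_apply (F : S.LocalFrame) (p) (hp : p ∈ F.U) (V) : σ V p = F.P3coeff f p * F.θ1 V p :=
    hσ F p hp V
  have σ_Z (F : S.LocalFrame) (p) (hp : p ∈ F.U) : σ F.Z p = F.P3coeff f p := by
    rw [σ_apply F p hp, F.θ1_Z p hp, mul_one]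
  exact ⟨σ, fun F p hp V => by rw [σ_apply F p hp, σ_Z F p hp], σ_Z⟩

variable (S) in
theorem exists_mem_dbar (f : CF M) : ∃ σ, (f, σ) ∈ S.dbar := by
  obtain ⟨σ, hσ⟩ := exists_glued_form (fun F : S.LocalFrame => F.Zbar f • conjForm F.θ1)
    fun F F' p hp V => LocalFrame.Zbar_mul_conjForm_θ1_eq hp.1 hp.2 f V
  have σ_apply (F : S.LocalFrame) (p) (hp : p ∈ F.U) (V) :
      σ V p = F.Zbar f p * conjForm F.θ1 V p := hσ F p hp V
  have σ_Zbar (F : S.LocalFrame) (p) (hp : p ∈ F.U) : σ F.Zbar p = F.Zbar f p := by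
    rw [σ_apply F p hp, ← LocalFrame.conjV_Z, (LocalFrame.isDualAt hp).conjForm_θ1_Zbar, mul_one]
  exact ⟨σ, fun F p hp V => by rw [σ_apply F p hp, σ_Zbar F p hp], σ_Zbar⟩

theorem F20_ext (hη : η ∈ S.F20) (hη' : η' ∈ S.F20)
    (h : ∀ F : S.LocalFrame, ∀ p ∈ F.U, η F.Z F.T p = η' F.Z F.T p) : η = η' := by
  ext V W p
  obtain ⟨F, hp⟩ := S.exists_localFrame p
  rw [hη F p hp, hη' F p hp, h F p hp]

theorem mem_P3F20_iff : (f, η) ∈ S.P3F20 ↔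
    η ∈ S.F20 ∧ ∀ F : S.LocalFrame, ∀ p ∈ F.U, η F.Z F.T p = F.P3coeff f p := by
  have wedgeθ_Z_T {σ} (hσ : (f, σ) ∈ S.P3) (F : S.LocalFrame) (p) (hp : p ∈ F.U) :
      S.wedgeθ σ F.Z F.T p = F.P3coeff f p :=
    (LocalFrame.wedge_θ_Z_T hp σ).trans (hσ.2 F p hp)
  constructor
  · rintro ⟨σ, hσ, rfl : η = S.wedgeθ σ⟩
    exact ⟨wedgeθ_mem_F20 hσ.1, wedgeθ_Z_T hσ⟩
  · rintro ⟨hη, η_Z_T⟩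
    obtain ⟨σ, hσ⟩ := S.exists_mem_P3 f
    refine ⟨σ, hσ, F20_ext hη (wedgeθ_mem_F20 hσ.1) fun F p hp => ?_⟩
    rw [η_Z_T F p hp, wedgeθ_Z_T hσ F p hp]

variable (S) in
theorem existsUnique_mem_P3F20 (f : CF M) : ∃! η, (f, η) ∈ S.P3F20 := by
  obtain ⟨σ, hσ⟩ := S.exists_mem_P3 f
  have hη : (f, S.wedgeθ σ) ∈ S.P3F20 := ⟨σ, hσ, rfl⟩
  refine ⟨_, hη, fun η' hη' => ?_⟩
  rw [mem_P3F20_iff] at hη hη'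
  exact F20_ext hη'.1 hη.1 fun F p hp => by rw [hη'.2 F p hp, hη.2 F p hp]

theorem mem_DplusDbar_iff : (f, η) ∈ S.DplusDbar ↔
    η ∈ S.F20 ∧ ∀ F : S.LocalFrame, ∀ p ∈ F.U, η F.Z F.T p = Complex.I * F.P3coeff f p := by
  have Dplus_coeff {σ} (hσ : (f, σ) ∈ S.dbar) (F : S.LocalFrame) (p) (hp : p ∈ F.U) :
      (Complex.I • F.cbar11 (σ F.Zbar) - F.A11 * σ F.Zbar) p = Complex.I * F.P3coeff f p := by
    rw [CF.sub_apply, CF.smul_apply, CF.mul_apply, LocalFrame.cbar11_congr (hσ.2 F) hp,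
      hσ.2 F p hp, LocalFrame.P3coeff, CF.add_apply, CF.smul_apply, CF.mul_apply]
    linear_combination (-F.A11 p * F.Zbar f p) * Complex.I_mul_I
  constructor
  · rintro ⟨σ, hσ, -, hη, η_Z_T⟩
    exact ⟨hη, fun F p hp => (η_Z_T F p hp).trans (Dplus_coeff hσ F p hp)⟩
  · rintro ⟨hη, η_Z_T⟩
    obtain ⟨σ, hσ⟩ := S.exists_mem_dbar f
    exact ⟨σ, hσ, hσ.1, hη, fun F p hp => (η_Z_T F p hp).trans (Dplus_coeff hσ F p hp).symm⟩

variable (S) in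
theorem mem_DplusDbar_iff_smul_mem_P3F20 (f : CF M) (η : Form2 M) :
    (f, η) ∈ S.DplusDbar ↔ (f, -Complex.I • η) ∈ S.P3F20 := by
  rw [mem_DplusDbar_iff, mem_P3F20_iff]
  refine and_congr ((S.F20.restrictScalars ℂ).smul_mem_iff (neg_ne_zero.2 Complex.I_ne_zero)).symm
    (forall₃_congr fun F p _ => ?_)
  change _ ↔ -Complex.I * η F.Z F.T p = F.P3coeff f p
  constructor <;> intro h
  · linear_combination -Complex.I * h - F.P3coeff f p * Complex.I_mul_I
  · linear_combination Complex.I * h + η F.Z F.T p * Complex.I_mul_I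

theorem mem_dbarF20_wedgeθ_iff (hσ : σ ∈ S.E10) :
    (S.wedgeθ σ, Complex.I • g) ∈ S.dbarF20 ↔ (σ, g) ∈ S.divergence := by
  have c1bar_eq (F : S.LocalFrame) (p) (hp : p ∈ F.U) :
      F.c1bar (S.wedgeθ σ F.Z F.T) p = F.c1bar (σ F.Z) p :=
    LocalFrame.c1bar_congr (fun q hq => LocalFrame.wedge_θ_Z_T hq σ) hp
  refine (and_iff_right (wedgeθ_mem_F20 hσ)).trans (Iff.trans ?_ (and_iff_right hσ).symm)
  refine forall₃_congr fun F p hp => ?_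
  change Complex.I * g p = Complex.I * F.c1bar (S.wedgeθ σ F.Z F.T) p ↔ g p = F.c1bar (σ F.Z) p
  rw [c1bar_eq F p hp, mul_right_inj' Complex.I_ne_zero]

variable (S) in
theorem mem_P4_iff_smul_mem_relComp (f g : CF M) :
    (f, g) ∈ S.P4 ↔ (f, Complex.I • g) ∈ relComp S.P3F20 S.dbarF20 := by
  constructor
  · rintro ⟨σ, hσ, hg⟩
    exact ⟨S.wedgeθ σ, ⟨σ, hσ, rfl⟩, (mem_dbarF20_wedgeθ_iff hσ.1).2 hg⟩
  · rintro ⟨η, ⟨σ, hσ, rfl : η = S.wedgeθ σ⟩, hg⟩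
    exact ⟨σ, hσ, (mem_dbarF20_wedgeθ_iff hσ.1).1 hg⟩

theorem mem_relKer_P3F20_iff :
    f ∈ relKer S.P3F20 ↔ ∀ F : S.LocalFrame, ∀ p ∈ F.U, F.P3coeff f p = 0 := by
  refine mem_P3F20_iff.trans ((and_iff_right S.F20.zero_mem).trans (forall₃_congr fun F p _ => ?_))
  exact eq_comm

variable (S)

theorem relKer_P3F20 : relKer S.P3F20 = relKer S.P3 := by
  ext f
  rw [mem_relKer_P3F20_iff]
  refine Iff.trans (forall₃_congr fun F p _ => ?_) (and_iff_right S.E10.zero_mem).symm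
  exact eq_comm

theorem relKer_P4 : relKer S.P4 = relKer (relComp S.P3F20 S.dbarF20) :=
  relKer_eq_of_iff_smul_mem S.mem_P4_iff_smul_mem_relComp

theorem relKer_DplusDbar : relKer S.DplusDbar = relKer S.P3F20 :=
  relKer_eq_of_iff_smul_mem S.mem_DplusDbar_iff_smul_mem_P3F20

theorem relIm_DplusDbar : relIm S.DplusDbar = relIm S.P3F20 :=
  relIm_eq_of_iff_smul_mem (neg_ne_zero.2 Complex.I_ne_zero) S.mem_DplusDbar_iff_smul_mem_P3F20

theorem relKer_relComp_DplusDbar_dbarF20 :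
    relKer (relComp S.DplusDbar S.dbarF20) = relKer S.P4 := by
  rw [relKer_P4]
  exact relKer_eq_of_iff_smul_mem (relComp_iff_smul_mem (neg_ne_zero.2 Complex.I_ne_zero)
    S.mem_DplusDbar_iff_smul_mem_P3F20)

theorem existsUnique_mem_DplusDbar (f : CF M) : ∃! η, (f, η) ∈ S.DplusDbar :=
  existsUnique_mem_of_iff_smul_mem (neg_ne_zero.2 Complex.I_ne_zero)
    (S.mem_DplusDbar_iff_smul_mem_P3F20 f) (S.existsUnique_mem_P3F20 f)

theorem relKer_onReal_P3F20 : relKer (onReal S.P3F20) = S.pluriharmonic := by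
  ext f
  rw [relKer_onReal, mem_pluriharmonic_iff, ← mem_relKer_P3F20_iff]
  exact and_comm

theorem relKer_onReal_DplusDbar : relKer (onReal S.DplusDbar) = S.pluriharmonic := by
  rw [relKer_onReal, relKer_DplusDbar, ← relKer_onReal, relKer_onReal_P3F20]

end Pseudohermitian

end Operators

end CR

end

theorem lemma2p23_general (M : Type*) [TopologicalSpace M] [T2Space M]
    [ChartedSpace (EuclideanSpace ℝ (Fin 3)) M]
    [IsManifold (𝓡 3) ∞ M]
    (S : CR.Pseudohermitian M) :
    (∀ f : CR.CF M, ∃! η, (f, η) ∈ S.P3F20) ∧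
    (∀ f : CR.CF M, ∃! η, (f, η) ∈ S.DplusDbar) ∧
    (∀ (f : CR.CF M) (η : CR.Form2 M),
      (f, η) ∈ S.DplusDbar → (f, -Complex.I • η) ∈ S.P3F20) ∧
    (∀ W : Submodule ℝ (CR.CF M),
      CR.IsSupplementary (CR.relKer (CR.onReal S.P4)) S.pluriharmonic W →
        CR.IsIsoOnto (CR.onReal S.P3F20) W
          ((CR.relKer S.dbarF20).restrictScalars ℝ ⊓ CR.relIm (CR.onReal S.P3F20)) ∧
        CR.IsIsoOnto (CR.onReal S.DplusDbar) W
          ((CR.relKer S.dbarF20).restrictScalars ℝ ⊓ CR.relIm (CR.onReal S.DplusDbar))) ∧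
    (∀ W : Submodule ℂ (CR.CF M),
      CR.IsSupplementary (CR.relKer S.P4) (CR.relKer S.P3) W →
        CR.IsIsoOnto S.P3F20 W (CR.relKer S.dbarF20 ⊓ CR.relIm S.P3F20) ∧
        CR.IsIsoOnto S.P3F20 W (CR.relKer S.dbarF20 ⊓ CR.relIm S.DplusDbar)) := by
  refine ⟨S.existsUnique_mem_P3F20, S.existsUnique_mem_DplusDbar,
    fun f η => (S.mem_DplusDbar_iff_smul_mem_P3F20 f η).1, fun W hW => ⟨?_, ?_⟩, fun W hW => ?_⟩
  · rw [CR.relKer_onReal, S.relKer_P4, ← CR.relKer_onReal, ← S.relKer_onReal_P3F20] at hW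
    exact hW.isIsoOnto_onReal fun f _ _ => (S.existsUnique_mem_P3F20 f).unique
  · rw [CR.relKer_onReal, ← S.relKer_relComp_DplusDbar_dbarF20, ← CR.relKer_onReal,
      ← S.relKer_onReal_DplusDbar] at hW
    exact hW.isIsoOnto_onReal fun f _ _ => (S.existsUnique_mem_DplusDbar f).unique
  · rw [S.relIm_DplusDbar, and_self]
    rw [S.relKer_P4, ← S.relKer_P3F20] at hW
    exact hW.isIsoOnto fun f _ _ => (S.existsUnique_mem_P3F20 f).unique

theorem lemma2p23 (M : Type*) [TopologicalSpace M] [T2Space M] [SigmaCompactSpace M]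
    [ChartedSpace (EuclideanSpace ℝ (Fin 3)) M]
    [IsManifold (𝓡 3) ∞ M]
    (S : CR.Pseudohermitian M) :
    -- `P_3` and `D^+ d''` are everywhere defined, single-valued, and `P_3 = -i D^+ d''`
    (∀ f : CR.CF M, ∃! η, (f, η) ∈ S.P3F20) ∧
    (∀ f : CR.CF M, ∃! η, (f, η) ∈ S.DplusDbar) ∧
    (∀ (f : CR.CF M) (η : CR.Form2 M),
      (f, η) ∈ S.DplusDbar → (f, -Complex.I • η) ∈ S.P3F20) ∧
    -- real-valued functions, `𝒫` the CR pluriharmonic functions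
    (∀ W : Submodule ℝ (CR.CF M),
      CR.IsSupplementary (CR.relKer (CR.onReal S.P4)) S.pluriharmonic W →
        CR.IsIsoOnto (CR.onReal S.P3F20) W
          ((CR.relKer S.dbarF20).restrictScalars ℝ ⊓ CR.relIm (CR.onReal S.P3F20)) ∧
        CR.IsIsoOnto (CR.onReal S.DplusDbar) W
          ((CR.relKer S.dbarF20).restrictScalars ℝ ⊓ CR.relIm (CR.onReal S.DplusDbar))) ∧
    -- complex-valued functions, `𝒫 = ker P_3`
    (∀ W : Submodule ℂ (CR.CF M),
      CR.IsSupplementary (CR.relKer S.P4) (CR.relKer S.P3) W →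
        CR.IsIsoOnto S.P3F20 W (CR.relKer S.dbarF20 ⊓ CR.relIm S.P3F20) ∧
        CR.IsIsoOnto S.P3F20 W (CR.relKer S.dbarF20 ⊓ CR.relIm S.DplusDbar)) :=
  lemma2p23_general M S
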